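/- Let $G$ be a finite group. Let $\overline{\mathcal A}_G$ (respectively $\overline{\mathcal U}_G$) be the category whose objects are the finite $G$-sets and whose morphisms from $X$ to $Y$ are the isomorphism classes of diagrams $X\leftarrow A\to Y$ (respectively $X\xleftarrow{p}A\xrightarrow{q}B\xrightarrow{r}Y$) of finite $G$-sets and equivariant maps. Spans are composed by pullback. The composite of $X_0\xleftarrow{p_0}A_0\xrightarrow{q_0}B_0\xrightarrow{r_0}X_1$ followed by $X_1\xleftarrow{p_1}A_1\xrightarrow{q_1}B_1\xrightarrow{r_1}X_2$ is $X_0\leftarrow A\to B\to X_2$, where $$B=\{(b_1,s)\mid b_1\in B_1,\ s\colon q_1^{-1}\{b_1\}\to B_0,\ r_0s=p_1\},\qquad A=\{(a_0,a_1,s)\mid (q_1(a_1),s)\in B,\ q_0(a_0)=s(a_1)\},$$ with $G$ acting on the maps $s$ by conjugation and with the maps $(a_0,a_1,s)\mapsto p_0(a_0)$, $(a_0,a_1,s)\mapsto(q_1(a_1),s)$, $(b_1,s)\mapsto r_1(b_1)$. For an equivariant map $f\colon X\to Y$ put $T_f=[X=X=X\xrightarrow{f}Y]$, $N_f=[X=X\xrightarrow{f}Y=Y]$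 and $R_f=[Y\xleftarrow{f}X=X=X]$ in $\overline{\mathcal U}_G$, and $T_f=[X=X\xrightarrow{f}Y]$, $R_f=[Y\xleftarrow{f}X=X]$ in $\overline{\mathcal A}_G$. A Mackey functor (respectively a Tambara functor) for $G$ is a product-preserving functor from $\overline{\mathcal A}_G$ (respectively $\overline{\mathcal U}_G$) to sets; morphisms are natural transformations. (Additive inverses are not required.) Restriction along the functor $\overline{\mathcal A}_G\to\overline{\mathcal U}_G$, $[X\leftarrow A\to Y]\mapsto[X\leftarrow A=A\to Y]$, sends a Tambara functor to its underlying Mackey functor. For Mackey functors $M$ and $N$, let $M\boxtimes N\colon\overline{\mathcal A}_G\to\mathrm{Sets}$ be the Day box product, that is, the left Kan extension of $(X,Y)\mapsto M(X)\times N(Y)$ along $\times\colon\overline{\mathcal A}_G\times\overline{\mathcal A}_G\to\overline{\mathcal A}_G$. Write $m\boxtimes n\in(M\boxtimes N)(X\times Y)$ for the image of $(m,n)\in M(X)\times N(Y)$ under the universal pairing. For $(m,n)\in M(X)\times N(X)$ put $m\otimes n=R_\delta(m\boxtimes n)\in(M\boxtimes N)(X)$, where $\delta\colon X\to X\times X$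 is the diagonal. **Proposition.** Let $M$ and $N$ be Tambara functors for $G$. Then there is exactly one way to make the Mackey functor $M\boxtimes N$ into a Tambara functor (with the same underlying sets, transfers and restrictions) such that $$N_f(m\otimes n)=N_f(m)\otimes N_f(n)$$ for all equivariant maps $f\colon X\to Y$ of finite $G$-sets and all $(m,n)\in M(X)\times N(X)$. With this structure, $M\boxtimes N$ is the coproduct of $M$ and $N$ in the category of Tambara functors, with coproduct inclusions $M\to M\boxtimes N$, $m\mapsto m\otimes1$, and $N\to M\boxtimes N$, $n\mapsto1\otimes n$. Here, for a Tambara functor $S$, $1\in S(X)$ is the image under $N_z$ of the unique element of $S(\emptyset)$, where $z\colon\emptyset\to X$. -/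

import Mathlib

open CategoryTheory CategoryTheory.Limits

universe w u

/-! ## Finite `G`-sets -/

/-- A finite `G`-set. Equivariant maps are Mathlib's `X →[G] Y`. -/
structure FinGSet (G : Type u) [Group G] where
  carrier : Type u
  [action : MulAction G carrier]
  [finite : Finite carrier]

namespace FinGSet

variable {G : Type u} [Group G]

instance : CoeSort (FinGSet G) (Type u) := ⟨FinGSet.carrier⟩

instance (X : FinGSet G) : MulAction G X := X.action

instance (X : FinGSet G) : Finite X := X.finite

/-- The product `X × Y` with the diagonal action. -/
def prod (X Y : FinGSet G) : FinGSet G := ⟨X × Y⟩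

/-- The empty `G`-set. -/
def empty (G : Type u) [Group G] : FinGSet G :=
  letI : MulAction G PEmpty.{u + 1} :=
    { smul := fun _ x => x.elim, one_smul := fun x => x.elim, mul_smul := fun _ _ x => x.elim }
  ⟨PEmpty.{u + 1}⟩

/-- The unique map from the empty `G`-set. -/
def emptyMap (X : FinGSet G) : empty G →[G] X where
  toFun x := PEmpty.elim x
  map_smul' _ x := PEmpty.elim x

/-- The product of two equivariant maps. -/
def prodMap {X Y X' Y' : FinGSet G} (f : X →[G] Y) (f' : X' →[G] Y') :
    X.prod X' →[G] Y.prod Y' where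
  toFun x := (f x.1, f' x.2)
  map_smul' g x := Prod.ext (map_smul f g x.1) (map_smul f' g x.2)

/-- The diagonal map `δ : X → X × X`. -/
def diag (X : FinGSet G) : X →[G] X.prod X where
  toFun x := (x, x)
  map_smul' _ _ := rfl

end FinGSet

/-! ## Spans, and the category of finite `G`-sets and isomorphism classes of spans -/

section Span

variable {G : Type u} [Group G]

/-- An equivariant span `X ← A → Y` of finite `G`-sets. -/
structure GSpan (X Y : FinGSet G) where
  A : FinGSet G
  p : A →[G] X
  q : A →[G] Y

namespace GSpan

variable {X Y Z W : FinGSet G}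

/-- Two spans are isomorphic if there is an equivariant bijection between their middle terms
which is compatible with the maps to `X` and `Y`. -/
def IsIsomorphic (s t : GSpan X Y) : Prop :=
  ∃ e : s.A ≃ t.A, (∀ (g : G) (a : s.A), e (g • a) = g • e a) ∧
    (∀ a, t.p (e a) = s.p a) ∧ (∀ a, t.q (e a) = s.q a)

theorem IsIsomorphic.refl (s : GSpan X Y) : s.IsIsomorphic s :=
  ⟨Equiv.refl _, fun _ _ => rfl, fun _ => rfl, fun _ => rfl⟩

theorem IsIsomorphic.symm {s t : GSpan X Y} : s.IsIsomorphic t → t.IsIsomorphic s := by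
  rintro ⟨e, he, hp, hq⟩
  refine ⟨e.symm, fun g a => ?_, fun a => ?_, fun a => ?_⟩
  · rw [Equiv.symm_apply_eq, he, Equiv.apply_symm_apply]
  · rw [← hp, Equiv.apply_symm_apply]
  · rw [← hq, Equiv.apply_symm_apply]

theorem IsIsomorphic.trans {s t r : GSpan X Y} :
    s.IsIsomorphic t → t.IsIsomorphic r → s.IsIsomorphic r := by
  rintro ⟨e, he, hp, hq⟩ ⟨e', he', hp', hq'⟩
  refine ⟨e.trans e', fun g a => ?_, fun a => ?_, fun a => ?_⟩
  · simp [he, he']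
  · simp [hp, hp']
  · simp [hq, hq']

instance setoid (X Y : FinGSet G) : Setoid (GSpan X Y) :=
  ⟨IsIsomorphic, IsIsomorphic.refl, IsIsomorphic.symm, IsIsomorphic.trans⟩

/-- The identity span. -/
def id (X : FinGSet G) : GSpan X X := ⟨X, MulActionHom.id G, MulActionHom.id G⟩

/-- The span `T_f = (X = X → Y)` of an equivariant map `f : X → Y`. -/
def T (f : X →[G] Y) : GSpan X Y := ⟨X, MulActionHom.id G, f⟩

/-- The span `R_f = (Y ← X = X)` of an equivariant map `f : X → Y`. -/
def R (f : X →[G] Y) : GSpan Y X := ⟨X, f, MulActionHom.id G⟩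

/-- The pullback used to compose spans. -/
def Pull (s : GSpan X Y) (t : GSpan Y Z) : Type u := {a : s.A × t.A // s.q a.1 = t.p a.2}

instance (s : GSpan X Y) (t : GSpan Y Z) : Finite (Pull s t) :=
  inferInstanceAs (Finite {a : s.A × t.A // s.q a.1 = t.p a.2})

instance (s : GSpan X Y) (t : GSpan Y Z) : MulAction G (Pull s t) where
  smul g a := ⟨(g • a.1.1, g • a.1.2), by
    change s.q (g • a.1.1) = t.p (g • a.1.2)
    rw [map_smul, map_smul, a.2]⟩
  one_smul a := Subtype.ext (Prod.ext (one_smul G a.1.1) (one_smul G a.1.2))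
  mul_smul g h a := Subtype.ext (Prod.ext (mul_smul g h a.1.1) (mul_smul g h a.1.2))

/-- The composite of the span `s` from `X` to `Y` followed by the span `t` from `Y` to `Z`. -/
def comp (s : GSpan X Y) (t : GSpan Y Z) : GSpan X Z where
  A := ⟨Pull s t⟩
  p := { toFun := fun a => s.p a.1.1, map_smul' := fun g a => map_smul s.p g a.1.1 }
  q := { toFun := fun a => t.q a.1.2, map_smul' := fun g a => map_smul t.q g a.1.2 }

theorem comp_congr {s s' : GSpan X Y} {t t' : GSpan Y Z} :
    s.IsIsomorphic s' → t.IsIsomorphic t' → (s.comp t).IsIsomorphic (s'.comp t') := by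
  rintro ⟨e, he, hp, hq⟩ ⟨e', he', hp', hq'⟩
  refine ⟨(e.prodCongr e').subtypeEquiv fun a => ?_, fun g a => ?_, fun a => ?_, fun a => ?_⟩
  · simp [hq, hp']
  · exact Subtype.ext (Prod.ext (he _ _) (he' _ _))
  · exact hp _
  · exact hq' _

theorem id_comp (s : GSpan X Y) : ((id X).comp s).IsIsomorphic s :=
  ⟨{ toFun := fun a => a.1.2
     invFun := fun a => ⟨(s.p a, a), rfl⟩
     left_inv := fun a => Subtype.ext (Prod.ext a.2.symm rfl)
     right_inv := fun _ => rfl }, fun _ _ => rfl, fun a => a.2.symm, fun _ => rfl⟩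

theorem comp_id (s : GSpan X Y) : (s.comp (id Y)).IsIsomorphic s :=
  ⟨{ toFun := fun a => a.1.1
     invFun := fun a => ⟨(a, s.q a), rfl⟩
     left_inv := fun a => Subtype.ext (Prod.ext rfl a.2)
     right_inv := fun _ => rfl }, fun _ _ => rfl, fun _ => rfl, fun a => a.2⟩

theorem comp_assoc (s : GSpan X Y) (t : GSpan Y Z) (r : GSpan Z W) :
    ((s.comp t).comp r).IsIsomorphic (s.comp (t.comp r)) :=
  ⟨{ toFun := fun a => ⟨(a.1.1.1.1, ⟨(a.1.1.1.2, a.1.2), a.2⟩), a.1.1.2⟩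
     invFun := fun a => ⟨(⟨(a.1.1, a.1.2.1.1), a.2⟩, a.1.2.1.2), a.1.2.2⟩
     left_inv := fun _ => rfl
     right_inv := fun _ => rfl }, fun _ _ => rfl, fun _ => rfl, fun _ => rfl⟩

/-- The product of two spans. -/
def prod {X' Y' : FinGSet G} (s : GSpan X Y) (s' : GSpan X' Y') :
    GSpan (X.prod X') (Y.prod Y') :=
  ⟨s.A.prod s'.A, FinGSet.prodMap s.p s'.p, FinGSet.prodMap s.q s'.q⟩

end GSpan

/-- The category whose objects are the finite `G`-sets, and whose morphisms from `X` to `Y` are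
the isomorphism classes of equivariant spans `X ← A → Y`. -/
structure SpanCat (G : Type u) [Group G] where
  of ::
  set : FinGSet G

namespace SpanCat

instance : Category (SpanCat G) where
  Hom X Y := Quotient (GSpan.setoid X.set Y.set)
  id X := ⟦GSpan.id X.set⟧
  comp f g := Quotient.map₂ GSpan.comp (fun _ _ h _ _ h' => GSpan.comp_congr h h') f g
  id_comp f := Quotient.inductionOn f fun s => Quotient.sound (GSpan.id_comp s)
  comp_id f := Quotient.inductionOn f fun s => Quotient.sound (GSpan.comp_id s)
  assoc f g h := Quotient.inductionOn₃ f g h fun s t r =>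
    Quotient.sound (GSpan.comp_assoc s t r)

/-- The isomorphism class of a span, as a morphism. -/
def homMk {X Y : FinGSet G} (s : GSpan X Y) : of X ⟶ of Y := Quotient.mk _ s

/-- The product functor `(X, Y) ↦ X × Y`, given on morphisms by the product of spans. -/
def prodFunctor (G : Type u) [Group G] : SpanCat G × SpanCat G ⥤ SpanCat G where
  obj X := of (X.1.set.prod X.2.set)
  map f := Quotient.map₂ GSpan.prod (by
    rintro s s' ⟨e, he, hp, hq⟩ t t' ⟨e', he', hp', hq'⟩
    exact ⟨e.prodCongr e', fun g a => Prod.ext (he _ _) (he' _ _),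
      fun a => Prod.ext (hp _) (hp' _), fun a => Prod.ext (hq _) (hq' _)⟩) f.1 f.2
  map_id _ := rfl
  map_comp := by
    rintro _ _ _ ⟨f, f'⟩ ⟨g, g'⟩
    induction f, g using Quotient.inductionOn₂ with | _ f g
    induction f', g' using Quotient.inductionOn₂ with | _ f' g'
    refine Quotient.sound ⟨
      { toFun := fun a => ⟨((a.1.1.1, a.2.1.1), (a.1.1.2, a.2.1.2)), Prod.ext a.1.2 a.2.2⟩
        invFun := fun a => (⟨(a.1.1.1, a.1.2.1), congrArg Prod.fst a.2⟩,
          ⟨(a.1.1.2, a.1.2.2), congrArg Prod.snd a.2⟩)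
        left_inv := fun _ => rfl
        right_inv := fun _ => rfl }, fun _ _ => rfl, fun _ => rfl, fun _ => rfl⟩

end SpanCat

end Span

/-! ## Bispans, and the category of finite `G`-sets and isomorphism classes of bispans -/

section Bispan

variable {G : Type u} [Group G]

/-- An equivariant bispan `X ← A → B → Y` of finite `G`-sets. -/
structure Bispan (X Y : FinGSet G) where
  A : FinGSet G
  B : FinGSet G
  p : A →[G] X
  q : A →[G] B
  r : B →[G] Y

namespace Bispan

variable {X Y Z W : FinGSet G}

/-- Two bispans are isomorphic if there are equivariant bijections `α : A ≃ A'` and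
`β : B ≃ B'` making the evident diagram commute. -/
def IsIsomorphic (s t : Bispan X Y) : Prop :=
  ∃ (α : s.A ≃ t.A) (β : s.B ≃ t.B),
    (∀ (g : G) (a : s.A), α (g • a) = g • α a) ∧ (∀ (g : G) (b : s.B), β (g • b) = g • β b) ∧
    (∀ a, t.p (α a) = s.p a) ∧ (∀ a, t.q (α a) = β (s.q a)) ∧ (∀ b, t.r (β b) = s.r b)

theorem IsIsomorphic.refl (s : Bispan X Y) : s.IsIsomorphic s :=
  ⟨Equiv.refl _, Equiv.refl _, fun _ _ => rfl, fun _ _ => rfl, fun _ => rfl, fun _ => rfl,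
    fun _ => rfl⟩

theorem IsIsomorphic.symm {s t : Bispan X Y} : s.IsIsomorphic t → t.IsIsomorphic s := by
  rintro ⟨α, β, hα, hβ, hp, hq, hr⟩
  refine ⟨α.symm, β.symm, fun g a => ?_, fun g b => ?_, fun a => ?_, fun a => ?_, fun b => ?_⟩
  · rw [Equiv.symm_apply_eq, hα, Equiv.apply_symm_apply]
  · rw [Equiv.symm_apply_eq, hβ, Equiv.apply_symm_apply]
  · rw [← hp, Equiv.apply_symm_apply]
  · rw [Equiv.eq_symm_apply, ← hq, Equiv.apply_symm_apply]
  · rw [← hr, Equiv.apply_symm_apply]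

theorem IsIsomorphic.trans {s t r : Bispan X Y} :
    s.IsIsomorphic t → t.IsIsomorphic r → s.IsIsomorphic r := by
  rintro ⟨α, β, hα, hβ, hp, hq, hr⟩ ⟨α', β', hα', hβ', hp', hq', hr'⟩
  refine ⟨α.trans α', β.trans β', fun g a => ?_, fun g b => ?_, fun a => ?_, fun a => ?_,
    fun b => ?_⟩
  · simp [hα, hα']
  · simp [hβ, hβ']
  · simp [hp, hp']
  · simp [hq, hq']
  · simp [hr, hr']

instance setoid (X Y : FinGSet G) : Setoid (Bispan X Y) :=
  ⟨IsIsomorphic, IsIsomorphic.refl, IsIsomorphic.symm, IsIsomorphic.trans⟩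

/-- The identity bispan. -/
def id (X : FinGSet G) : Bispan X X :=
  ⟨X, X, MulActionHom.id G, MulActionHom.id G, MulActionHom.id G⟩

/-- The bispan `T_f = (X = X = X → Y)` of an equivariant map `f : X → Y`. -/
def T (f : X →[G] Y) : Bispan X Y := ⟨X, X, MulActionHom.id G, MulActionHom.id G, f⟩

/-- The bispan `N_f = (X = X → Y = Y)` of an equivariant map `f : X → Y`. -/
def N (f : X →[G] Y) : Bispan X Y := ⟨X, Y, MulActionHom.id G, f, MulActionHom.id G⟩

/-- The bispan `R_f = (Y ← X = X = X)` of an equivariant map `f : X → Y`. -/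
def R (f : X →[G] Y) : Bispan Y X := ⟨X, X, f, MulActionHom.id G, MulActionHom.id G⟩

/-- For bispans `s = (X ← A₀ → B₀ → Y)` and `t = (Y ← A₁ → B₁ → Z)`, the set of pairs `(b, σ)`
where `b ∈ B₁` and `σ : q₁⁻¹{b} → B₀` is a map (of sets) with `r₀ ∘ σ = p₁`. -/
structure CompB (s : Bispan X Y) (t : Bispan Y Z) : Type u where
  b : t.B
  σ : {a : t.A // t.q a = b} → s.B
  hσ : ∀ a, s.r (σ a) = t.p a.1

theorem CompB.ext' {s : Bispan X Y} {t : Bispan Y Z} {x y : CompB s t} (h : x.b = y.b)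
    (h' : ∀ (a : t.A) (hx : t.q a = x.b) (hy : t.q a = y.b), x.σ ⟨a, hx⟩ = y.σ ⟨a, hy⟩) :
    x = y := by
  obtain ⟨b, σ, hσ⟩ := x
  obtain ⟨b', σ', hσ'⟩ := y
  obtain rfl : b = b' := h
  obtain rfl : σ = σ' := funext fun a => h' a.1 a.2 a.2
  rfl

theorem CompB.σ_congr {s : Bispan X Y} {t : Bispan Y Z} {x y : CompB s t} (h : x = y)
    {a a' : t.A} (ha : a = a') (hx : t.q a = x.b) (hy : t.q a' = y.b) :
    x.σ ⟨a, hx⟩ = y.σ ⟨a', hy⟩ := by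
  subst h
  subst ha
  rfl

instance (s : Bispan X Y) (t : Bispan Y Z) : Finite (CompB s t) := by
  refine Finite.of_injective
    (β := Σ b : t.B, ({a : t.A // t.q a = b} → s.B)) (fun x => ⟨x.b, x.σ⟩) ?_
  rintro ⟨b, σ, hσ⟩ ⟨b', σ', hσ'⟩ h
  obtain ⟨h1, h2⟩ := Sigma.mk.inj h
  obtain rfl : b = b' := h1
  obtain rfl : σ = σ' := eq_of_heq h2
  rfl

/-- The action is `g • (b, σ) = (g • b, g ∘ σ ∘ g⁻¹)`. -/
instance (s : Bispan X Y) (t : Bispan Y Z) : MulAction G (CompB s t) where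
  smul g x :=
    { b := g • x.b
      σ := fun a => g • x.σ ⟨g⁻¹ • a.1, by rw [map_smul, a.2, inv_smul_smul]⟩
      hσ := fun a => by rw [map_smul, x.hσ, map_smul, smul_inv_smul] }
  one_smul x := CompB.ext' (one_smul G x.b) fun a hx hy =>
    (one_smul G _).trans (CompB.σ_congr rfl (by simp) _ _)
  mul_smul g h x := CompB.ext' (mul_smul g h x.b) fun a hx hy =>
    (mul_smul g h _).trans (congrArg (g • h • ·) (CompB.σ_congr rfl (by simp [mul_smul]) _ _))

theorem CompB.smul_b {s : Bispan X Y} {t : Bispan Y Z} (g : G) (x : CompB s t) :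
    (g • x).b = g • x.b := rfl

theorem CompB.smul_σ {s : Bispan X Y} {t : Bispan Y Z} (g : G) (x : CompB s t) (a : t.A)
    (ha : t.q a = (g • x).b) :
    (g • x).σ ⟨a, ha⟩ = g • x.σ ⟨g⁻¹ • a, by
      rw [map_smul, ha, CompB.smul_b, inv_smul_smul]⟩ := rfl

theorem CompB.smul_σ_smul {s : Bispan X Y} {t : Bispan Y Z} (g : G) (x : CompB s t) (a : t.A)
    (ha : t.q a = x.b) (ha' : t.q (g • a) = (g • x).b) :
    (g • x).σ ⟨g • a, ha'⟩ = g • x.σ ⟨a, ha⟩ := by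
  rw [CompB.smul_σ]
  exact congrArg (g • ·) (CompB.σ_congr rfl (inv_smul_smul g a) _ _)

/-- For bispans `s = (X ← A₀ → B₀ → Y)` and `t = (Y ← A₁ → B₁ → Z)`, the set of triples
`(a₀, a₁, σ)` where `(q₁(a₁), σ)` lies in `CompB s t` (and is called `base` here), and
`q₀(a₀) = σ(a₁)`. -/
structure CompA (s : Bispan X Y) (t : Bispan Y Z) : Type u where
  base : CompB s t
  a₀ : s.A
  a₁ : t.A
  h₁ : t.q a₁ = base.b
  h₀ : s.q a₀ = base.σ ⟨a₁, h₁⟩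

theorem CompA.ext' {s : Bispan X Y} {t : Bispan Y Z} {x y : CompA s t} (h : x.base = y.base)
    (h₀ : x.a₀ = y.a₀) (h₁ : x.a₁ = y.a₁) : x = y := by
  cases x
  cases y
  cases h
  cases h₀
  cases h₁
  rfl

instance (s : Bispan X Y) (t : Bispan Y Z) : Finite (CompA s t) :=
  Finite.of_injective (β := CompB s t × s.A × t.A) (fun x => (x.base, x.a₀, x.a₁))
    fun _ _ h => CompA.ext' (congrArg Prod.fst h) (congrArg (fun z => z.2.1) h)
      (congrArg (fun z => z.2.2) h)

/-- The action is `g • (a₀, a₁, σ) = (g • a₀, g • a₁, g ∘ σ ∘ g⁻¹)`. -/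
instance (s : Bispan X Y) (t : Bispan Y Z) : MulAction G (CompA s t) where
  smul g x :=
    { base := g • x.base
      a₀ := g • x.a₀
      a₁ := g • x.a₁
      h₁ := by rw [map_smul, x.h₁, CompB.smul_b]
      h₀ := by rw [map_smul, x.h₀, CompB.smul_σ_smul] }
  one_smul x := CompA.ext' (one_smul G _) (one_smul G _) (one_smul G _)
  mul_smul g h x := CompA.ext' (mul_smul g h _) (mul_smul g h _) (mul_smul g h _)

/-- The composite of the bispan `s` from `X` to `Y` followed by the bispan `t` from `Y` to `Z`. -/
def comp (s : Bispan X Y) (t : Bispan Y Z) : Bispan X Z where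
  A := ⟨CompA s t⟩
  B := ⟨CompB s t⟩
  p := { toFun := fun x => s.p x.a₀, map_smul' := fun g x => map_smul s.p g x.a₀ }
  q := { toFun := fun x => x.base, map_smul' := fun _ _ => rfl }
  r := { toFun := fun x => t.r x.b, map_smul' := fun g x => map_smul t.r g x.b }

/-- A bijection criterion: to give an isomorphism between bispans it is enough to give bijective
equivariant maps. -/
theorem isIsomorphic_of_bijective {s t : Bispan X Y} (α : s.A → t.A) (β : s.B → t.B)
    (hα : Function.Bijective α) (hβ : Function.Bijective β)
    (eα : ∀ (g : G) (a : s.A), α (g • a) = g • α a)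
    (eβ : ∀ (g : G) (b : s.B), β (g • b) = g • β b)
    (hp : ∀ a, t.p (α a) = s.p a) (hq : ∀ a, t.q (α a) = β (s.q a))
    (hr : ∀ b, t.r (β b) = s.r b) : s.IsIsomorphic t :=
  ⟨Equiv.ofBijective α hα, Equiv.ofBijective β hβ, eα, eβ, hp, hq, hr⟩

theorem id_comp (s : Bispan X Y) : ((id X).comp s).IsIsomorphic s := by
  refine isIsomorphic_of_bijective (s := (id X).comp s) (t := s)
    (fun x : CompA (id X) s => x.a₁) (fun x : CompB (id X) s => x.b) ⟨?_, ?_⟩ ⟨?_, ?_⟩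
    (fun _ _ => rfl) (fun _ _ => rfl) (fun x => ?_) (fun x => x.h₁) (fun _ => rfl)
  · intro x y h
    have hb : x.base = y.base := CompB.ext' (by rw [← x.h₁, ← y.h₁]; exact congrArg s.q h)
      fun a hx hy => (x.base.hσ ⟨a, hx⟩).trans (y.base.hσ ⟨a, hy⟩).symm
    refine CompA.ext' hb ?_ h
    exact x.h₀.trans ((CompB.σ_congr hb h _ _).trans y.h₀.symm)
  · intro a
    exact ⟨⟨⟨s.q a, fun a' => s.p a'.1, fun _ => rfl⟩, s.p a, a, rfl, rfl⟩, rfl⟩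
  · intro x y h
    exact CompB.ext' h fun a hx hy => (x.hσ ⟨a, hx⟩).trans (y.hσ ⟨a, hy⟩).symm
  · intro b
    exact ⟨⟨b, fun a' => s.p a'.1, fun _ => rfl⟩, rfl⟩
  · exact (x.base.hσ ⟨x.a₁, x.h₁⟩).symm.trans (x.h₀.symm)

theorem comp_id (s : Bispan X Y) : (s.comp (id Y)).IsIsomorphic s := by
  have key : ∀ x y : CompB s (id Y), x.σ ⟨x.b, rfl⟩ = y.σ ⟨y.b, rfl⟩ → x = y := by
    intro x y h
    have hb : x.b = y.b := (x.hσ ⟨x.b, rfl⟩).symm.trans ((congrArg s.r h).trans (y.hσ ⟨y.b, rfl⟩))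
    refine CompB.ext' hb fun a hx hy => ?_
    exact (CompB.σ_congr rfl hx hx rfl).trans (h.trans (CompB.σ_congr rfl hy.symm rfl hy))
  refine isIsomorphic_of_bijective (s := s.comp (id Y)) (t := s)
    (fun x : CompA s (id Y) => x.a₀) (fun x : CompB s (id Y) => x.σ ⟨x.b, rfl⟩) ⟨?_, ?_⟩ ⟨?_, ?_⟩
    (fun _ _ => rfl) (fun g x => ?_) (fun _ => rfl) (fun x => ?_) (fun x => ?_)
  · intro x y h
    have hb : x.base = y.base := by
      apply key
      have hx : s.q x.a₀ = x.base.σ ⟨x.base.b, rfl⟩ := x.h₀.trans (CompB.σ_congr rfl x.h₁ _ _)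
      have hy : s.q y.a₀ = y.base.σ ⟨y.base.b, rfl⟩ := y.h₀.trans (CompB.σ_congr rfl y.h₁ _ _)
      rw [← hx, ← hy]
      exact congrArg s.q h
    exact CompA.ext' hb h (x.h₁.trans ((congrArg CompB.b hb).trans y.h₁.symm))
  · intro a
    exact ⟨⟨⟨s.r (s.q a), fun _ => s.q a, fun a' => a'.2.symm⟩, a, s.r (s.q a), rfl, rfl⟩, rfl⟩
  · exact key
  · intro b
    exact ⟨⟨s.r b, fun _ => b, fun a' => a'.2.symm⟩, rfl⟩
  · exact CompB.smul_σ_smul g x x.b rfl rfl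
  · exact x.h₀.trans (CompB.σ_congr rfl x.h₁ _ _)
  · exact x.hσ ⟨x.b, rfl⟩

theorem comp_congr {s s' : Bispan X Y} {t t' : Bispan Y Z} :
    s.IsIsomorphic s' → t.IsIsomorphic t' → (s.comp t).IsIsomorphic (s'.comp t') := by
  rintro ⟨α, β, hα, hβ, hp, hq, hr⟩ ⟨α', β', hα', hβ', hp', hq', hr'⟩
  have hq'' : ∀ a, t.q (α'.symm a) = β'.symm (t'.q a) := fun a => by
    rw [Equiv.eq_symm_apply, ← hq', Equiv.apply_symm_apply]
  have hα'' : ∀ (g : G) a, α'.symm (g • a) = g • α'.symm a := fun g a => by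
    rw [Equiv.symm_apply_eq, hα', Equiv.apply_symm_apply]
  let F : CompB s t → CompB s' t' := fun x =>
    { b := β' x.b
      σ := fun a => β (x.σ ⟨α'.symm a.1, by rw [hq'', a.2, Equiv.symm_apply_apply]⟩)
      hσ := fun a => by rw [hr, x.hσ, ← hp', Equiv.apply_symm_apply] }
  have Fσ : ∀ (x : CompB s t) (a : t.A) (h : t.q a = x.b) (h' : t'.q (α' a) = (F x).b),
      (F x).σ ⟨α' a, h'⟩ = β (x.σ ⟨a, h⟩) := fun x a h h' =>
    congrArg β (CompB.σ_congr rfl (α'.symm_apply_apply a) _ _)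
  have Fsmul : ∀ (g : G) x, F (g • x) = g • F x := fun g x =>
    CompB.ext' (hβ' g x.b) fun a hx hy => by
      rw [CompB.smul_σ]
      change β (g • x.σ ⟨g⁻¹ • α'.symm a, _⟩) = g • β (x.σ ⟨α'.symm (g⁻¹ • a), _⟩)
      rw [hβ]
      exact congrArg (fun b => g • β b) (CompB.σ_congr rfl (hα'' _ _).symm _ _)
  have Finj : Function.Injective F := by
    intro x y h
    have hb : x.b = y.b := β'.injective (congrArg CompB.b h)
    refine CompB.ext' hb fun a hx hy => β.injective ?_
    have h1 : t'.q (α' a) = (F x).b := by rw [hq', hx]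
    have h2 : t'.q (α' a) = (F y).b := by rw [hq', hy]
    rw [← Fσ x a hx h1, ← Fσ y a hy h2]
    exact CompB.σ_congr h rfl _ _
  let A : CompA s t → CompA s' t' := fun x =>
    { base := F x.base
      a₀ := α x.a₀
      a₁ := α' x.a₁
      h₁ := by rw [hq', x.h₁]
      h₀ := by rw [hq, x.h₀, Fσ] }
  have Fsurj : ∀ y : CompB s' t', ∃ x, F x = y := by
    intro y
    refine ⟨⟨β'.symm y.b, fun a => β.symm (y.σ ⟨α' a.1, by
      rw [hq', a.2, Equiv.apply_symm_apply]⟩), fun a => ?_⟩, ?_⟩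
    · rw [← hr, Equiv.apply_symm_apply, y.hσ, hp']
    · refine CompB.ext' (β'.apply_symm_apply _) fun a hx hy => ?_
      exact (β.apply_symm_apply _).trans (CompB.σ_congr rfl (α'.apply_symm_apply a) _ _)
  refine isIsomorphic_of_bijective (s := s.comp t) (t := s'.comp t') A F ⟨?_, ?_⟩
    ⟨Finj, Fsurj⟩ (fun g x => CompA.ext' (Fsmul g _) (hα _ _) (hα' _ _)) Fsmul
    (fun x => hp _) (fun _ => rfl) (fun x => hr' _)
  · intro x y h
    exact CompA.ext' (Finj (congrArg CompA.base h)) (α.injective (congrArg CompA.a₀ h))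
      (α'.injective (congrArg CompA.a₁ h))
  · intro y
    obtain ⟨x, hx⟩ := Fsurj y.base
    have h1 : t.q (α'.symm y.a₁) = x.b := by
      rw [hq'', y.h₁, ← hx, Equiv.symm_apply_apply]
    refine ⟨⟨x, α.symm y.a₀, α'.symm y.a₁, h1, β.injective ?_⟩,
      CompA.ext' hx (α.apply_symm_apply _) (α'.apply_symm_apply _)⟩
    have h2 : t'.q (α' (α'.symm y.a₁)) = (F x).b := by rw [hq', h1]
    rw [← hq, Equiv.apply_symm_apply, y.h₀, ← Fσ x _ h1 h2]
    exact CompB.σ_congr hx.symm (α'.apply_symm_apply _).symm _ _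

theorem comp_assoc (s : Bispan X Y) (t : Bispan Y Z) (r : Bispan Z W) :
    ((s.comp t).comp r).IsIsomorphic (s.comp (t.comp r)) := by
  let F : CompB (s.comp t) r → CompB s (t.comp r) := fun x =>
    { b := ⟨x.b, fun a => CompB.b (x.σ a), fun a => x.hσ a⟩
      σ := fun c => CompB.σ (x.σ ⟨CompA.a₁ c.1, (CompA.h₁ c.1).trans (congrArg CompB.b c.2)⟩)
        ⟨CompA.a₀ c.1, (CompA.h₀ c.1).trans (CompB.σ_congr c.2 rfl _ _)⟩
      hσ := fun c => CompB.hσ _ _ }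
  let F' : CompB s (t.comp r) → CompB (s.comp t) r := fun y =>
    { b := CompB.b y.b
      σ := fun a =>
        { b := CompB.σ y.b a
          σ := fun a' => y.σ ⟨⟨y.b, a'.1, a.1, a.2, a'.2⟩, rfl⟩
          hσ := fun a' => y.hσ _ }
      hσ := fun a => CompB.hσ y.b a }
  have FF' : ∀ y, F (F' y) = y := by
    intro y
    refine CompB.ext' rfl fun c hx hy => ?_
    have e : (⟨y.b, CompA.a₀ c, CompA.a₁ c, (CompA.h₁ c).trans (congrArg CompB.b hy),
        (CompA.h₀ c).trans (CompB.σ_congr hy rfl _ _)⟩ : CompA t r) = c :=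
      CompA.ext' hy.symm rfl rfl
    exact CompB.σ_congr (x := y) (y := y) rfl e rfl hy
  have F'F : ∀ x, F' (F x) = x := fun x => rfl
  have Fsmul : ∀ (g : G) x, F (g • x) = g • F x := by
    intro g x
    refine CompB.ext' rfl fun c hx hy => ?_
    rw [CompB.smul_σ]
    rfl
  refine isIsomorphic_of_bijective (s := (s.comp t).comp r) (t := s.comp (t.comp r))
    (fun x : CompA (s.comp t) r =>
      (⟨F x.base, CompA.a₀ x.a₀,
        ⟨(F x.base).b, CompA.a₁ x.a₀, x.a₁, x.h₁,
          (CompA.h₁ x.a₀).trans (congrArg CompB.b x.h₀)⟩, rfl,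
        (CompA.h₀ x.a₀).trans (CompB.σ_congr x.h₀ rfl _ _)⟩ : CompA s (t.comp r))) F ⟨?_, ?_⟩
    ⟨Function.LeftInverse.injective F'F, Function.RightInverse.surjective FF'⟩
    (fun g x => ?_) Fsmul (fun _ => rfl) (fun _ => rfl) (fun _ => rfl)
  · intro x y h
    have hb : x.base = y.base := Function.LeftInverse.injective F'F (congrArg CompA.base h)
    have h₁ : x.a₁ = y.a₁ := congrArg (fun z : CompA s (t.comp r) => CompA.a₁ z.a₁) h
    refine CompA.ext' hb (CompA.ext' ?_
      (congrArg (fun z : CompA s (t.comp r) => CompA.a₀ z) h)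
      (congrArg (fun z : CompA s (t.comp r) => CompA.a₀ z.a₁) h)) h₁
    exact x.h₀.trans ((CompB.σ_congr hb h₁ _ _).trans y.h₀.symm)
  · intro y
    obtain ⟨x, hx⟩ := Function.RightInverse.surjective FF' y.base
    obtain ⟨yb, a₀, c, h₁, h₀⟩ := y
    obtain rfl : F x = yb := hx
    obtain ⟨cb, a₁, a₂, k₁, k₀⟩ := c
    obtain rfl : cb = (F x).b := h₁
    exact ⟨⟨x, ⟨x.σ ⟨a₂, k₁⟩, a₀, a₁, k₀, h₀⟩, a₂, k₁, rfl⟩, rfl⟩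
  · exact CompA.ext' (Fsmul g _) rfl (CompA.ext' rfl rfl rfl)

end Bispan

/-- The category whose objects are the finite `G`-sets, and whose morphisms from `X` to `Y` are
the isomorphism classes of equivariant bispans `X ← A → B → Y`. -/
structure BispanCat (G : Type u) [Group G] where
  of ::
  set : FinGSet G

namespace BispanCat

instance : Category (BispanCat G) where
  Hom X Y := Quotient (Bispan.setoid X.set Y.set)
  id X := ⟦Bispan.id X.set⟧
  comp f g := Quotient.map₂ Bispan.comp (fun _ _ h _ _ h' => Bispan.comp_congr h h') f g
  id_comp f := Quotient.inductionOn f fun s => Quotient.sound (Bispan.id_comp s)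
  comp_id f := Quotient.inductionOn f fun s => Quotient.sound (Bispan.comp_id s)
  assoc f g h := Quotient.inductionOn₃ f g h fun s t r =>
    Quotient.sound (Bispan.comp_assoc s t r)

/-- The isomorphism class of a bispan, as a morphism. -/
def homMk {X Y : FinGSet G} (s : Bispan X Y) : of X ⟶ of Y := Quotient.mk _ s

end BispanCat

/-- The bispan `X ← A = A → Y` of a span `X ← A → Y`. -/
def GSpan.toBispan {X Y : FinGSet G} (s : GSpan X Y) : Bispan X Y :=
  ⟨s.A, s.A, s.p, MulActionHom.id G, s.q⟩

theorem GSpan.toBispan_comp {X Y Z : FinGSet G} (s : GSpan X Y) (t : GSpan Y Z) :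
    (s.comp t).toBispan.IsIsomorphic (s.toBispan.comp t.toBispan) := by
  let F : GSpan.Pull s t → Bispan.CompB s.toBispan t.toBispan := fun x =>
    { b := x.1.2
      σ := fun _ => x.1.1
      hσ := fun a => x.2.trans (congrArg t.p a.2.symm) }
  refine Bispan.isIsomorphic_of_bijective (s := (s.comp t).toBispan)
    (t := s.toBispan.comp t.toBispan)
    (fun x : GSpan.Pull s t =>
      (⟨F x, x.1.1, x.1.2, rfl, rfl⟩ : Bispan.CompA s.toBispan t.toBispan)) F ⟨?_, ?_⟩ ⟨?_, ?_⟩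
    (fun _ _ => rfl) (fun _ _ => rfl) (fun _ => rfl) (fun _ => rfl) (fun _ => rfl)
  · intro x y h
    exact Subtype.ext (Prod.ext (congrArg Bispan.CompA.a₀ h) (congrArg Bispan.CompA.a₁ h))
  · intro y
    have h : s.q y.a₀ = t.p y.a₁ := (congrArg s.q y.h₀).trans (y.base.hσ ⟨y.a₁, y.h₁⟩)
    refine ⟨⟨(y.a₀, y.a₁), h⟩, Bispan.CompA.ext' (Bispan.CompB.ext' y.h₁ fun a hx hy => ?_)
      rfl rfl⟩
    exact y.h₀.trans (Bispan.CompB.σ_congr rfl (y.h₁.trans hy.symm) _ _)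
  · intro x y h
    exact Subtype.ext (Prod.ext (Bispan.CompB.σ_congr (x := F x) (y := F y) h
      (congrArg Bispan.CompB.b h) rfl rfl) (congrArg Bispan.CompB.b h))
  · intro y
    refine ⟨⟨(y.σ ⟨y.b, rfl⟩, y.b), y.hσ ⟨y.b, rfl⟩⟩, Bispan.CompB.ext' rfl fun a hx hy => ?_⟩
    have e : y.b = a := hy.symm
    exact Bispan.CompB.σ_congr (x := y) (y := y) rfl e rfl hy

/-- The functor from spans to bispans which is the identity on objects and sends
`X ← A → Y` to `X ← A = A → Y`. It sends `T_f` to `T_f` and `R_f` to `R_f`. -/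
def spanToBispan (G : Type u) [Group G] : SpanCat G ⥤ BispanCat G where
  obj X := .of X.set
  map f := Quotient.map GSpan.toBispan (by
    rintro _ _ ⟨e, he, hp, hq⟩
    exact ⟨e, e, he, he, hp, fun _ => rfl, hq⟩) f
  map_id _ := rfl
  map_comp f g := Quotient.inductionOn₂ f g fun s t => Quotient.sound (GSpan.toBispan_comp s t)

end Bispan

/-! ## The category of spans is essentially small -/

section Small

variable {G : Type u} [Group G]

namespace FinGSet

/-- The finite `G`-set given by an action on `Fin n`. -/
def ofCode (c : Σ n : ℕ, MulAction G (Fin n)) : FinGSet G :=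
  letI := c.2
  ⟨ULift.{u} (Fin c.1)⟩

theorem exists_code (X : FinGSet G) :
    ∃ (c : Σ n : ℕ, MulAction G (Fin n)) (e : X ≃ ofCode c),
      ∀ (g : G) (x : X), e (g • x) = g • e x := by
  obtain ⟨n, ⟨e⟩⟩ := Finite.exists_equiv_fin X
  let act : MulAction G (Fin n) :=
    { smul := fun g i => e (g • e.symm i)
      one_smul := fun i => by
        change e ((1 : G) • e.symm i) = i
        simp
      mul_smul := fun g h i => by
        change e ((g * h) • e.symm i) = e (g • e.symm (e (h • e.symm i)))
        simp [mul_smul] }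
  refine ⟨⟨n, act⟩, e.trans Equiv.ulift.symm, fun g x => ?_⟩
  change ULift.up (e (g • x)) = ULift.up (e (g • e.symm (e x)))
  simp

end FinGSet

variable [Finite G]

instance : Countable (Σ n : ℕ, MulAction G (Fin n)) := by
  have : ∀ n : ℕ, Countable (MulAction G (Fin n)) := fun n =>
    Function.Injective.countable (β := G → Fin n → Fin n)
      (f := fun a => a.toSMul.smul) fun a b h => MulAction.ext h
  infer_instance

namespace SpanCat

instance (X Y : FinGSet G) : Countable (X →[G] Y) :=
  Function.Injective.countable (β := X → Y) (f := fun f => f) DFunLike.coe_injective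

instance (X Y : SpanCat G) : Countable (X ⟶ Y) := by
  refine Function.Surjective.countable
    (α := Σ c : (Σ n : ℕ, MulAction G (Fin n)),
      (FinGSet.ofCode c →[G] X.set) × (FinGSet.ofCode c →[G] Y.set))
    (f := fun x => (⟦⟨FinGSet.ofCode x.1, x.2.1, x.2.2⟩⟧ : Quotient (GSpan.setoid X.set Y.set))) ?_
  refine fun f => Quotient.inductionOn f fun s => ?_
  obtain ⟨c, e, he⟩ := s.A.exists_code
  have he' : ∀ (g : G) x, e.symm (g • x) = g • e.symm x := fun g x => by
    rw [Equiv.symm_apply_eq, he, Equiv.apply_symm_apply]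
  refine ⟨⟨c, ⟨fun x => s.p (e.symm x), fun g x => ?_⟩, ⟨fun x => s.q (e.symm x), fun g x => ?_⟩⟩,
    Quotient.sound ⟨e.symm, he', fun _ => rfl, fun _ => rfl⟩⟩
  · rw [he', map_smul]; rfl
  · rw [he', map_smul]; rfl

instance : EssentiallySmall.{w} (SpanCat G) := by
  refine (essentiallySmall_iff _).2 ⟨?_, ⟨fun X Y => inferInstance⟩⟩
  have : Countable (Skeleton (SpanCat G)) := by
    refine Function.Surjective.countable (α := Σ n : ℕ, MulAction G (Fin n))
      (f := fun c => toSkeleton (of (FinGSet.ofCode c))) fun X => ?_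
    obtain ⟨c, e, he⟩ := ((fromSkeleton (SpanCat G)).obj X).set.exists_code
    refine ⟨c, ?_⟩
    have he' : ∀ (g : G) x, e.symm (g • x) = g • e.symm x := fun g x => by
      rw [Equiv.symm_apply_eq, he, Equiv.apply_symm_apply]
    let i : (fromSkeleton (SpanCat G)).obj X ≅ of (FinGSet.ofCode c) :=
      { hom := homMk (GSpan.T ⟨e, he⟩)
        inv := homMk (GSpan.T ⟨e.symm, he'⟩)
        hom_inv_id := Quotient.sound
          ⟨{ toFun := fun a => a.1.1
             invFun := fun a => ⟨(a, e a), rfl⟩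
             left_inv := fun a => Subtype.ext (Prod.ext rfl a.2)
             right_inv := fun _ => rfl }, fun _ _ => rfl, fun _ => rfl,
            fun a => (e.symm_apply_apply a.1.1).symm.trans (congrArg e.symm a.2)⟩
        inv_hom_id := Quotient.sound
          ⟨{ toFun := fun a => a.1.1
             invFun := fun a => ⟨(a, e.symm a), rfl⟩
             left_inv := fun a => Subtype.ext (Prod.ext rfl a.2)
             right_inv := fun _ => rfl }, fun _ _ => rfl, fun _ => rfl,
            fun a => (e.apply_symm_apply a.1.1).symm.trans (congrArg e a.2)⟩ }
    exact toSkeleton_eq_iff.2 ⟨i.symm⟩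
  infer_instance

end SpanCat

end Small

/-! ## The box product -/

section Box

variable {G : Type u} [Group G]

/-- The functor `(X, Y) ↦ M(X) × N(Y)`. -/
def externalProd (M N : SpanCat G ⥤ Type w) : SpanCat G × SpanCat G ⥤ Type w where
  obj X := M.obj X.1 × N.obj X.2
  map f := TypeCat.ofHom fun x => (M.map f.1 x.1, N.map f.2 x.2)
  map_id X := by ext x <;> simp
  map_comp f g := by ext x <;> simp

variable [Finite G]

instance (M N : SpanCat G ⥤ Type w) :
    (SpanCat.prodFunctor G).HasLeftKanExtension (externalProd M N) := by
  have : EssentiallySmall.{w} (SpanCat G × SpanCat G) :=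
    ⟨_, inferInstance, ⟨(equivSmallModel.{w} (SpanCat G)).prod (equivSmallModel.{w} (SpanCat G))⟩⟩
  have (X : SpanCat G) : HasColimitsOfShape (CostructuredArrow (SpanCat.prodFunctor G) X)
    (Type w) := hasColimitsOfShape_of_essentiallySmall.{w} _ _
  infer_instance

/-- The Day box product of `M` and `N`: the left Kan extension, in the category of sets, of
`(X, Y) ↦ M(X) × N(Y)` along the functor `(X, Y) ↦ X × Y`. -/
noncomputable def boxProd (M N : SpanCat G ⥤ Type w) : SpanCat G ⥤ Type w :=
  (SpanCat.prodFunctor G).leftKanExtension (externalProd M N)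

variable {M N : SpanCat G ⥤ Type w}

/-- The universal pairing `M(X) × N(Y) → (M ⊠ N)(X × Y)`, `(m, n) ↦ m ⊠ n`. -/
noncomputable def boxElt {X Y : FinGSet G} (m : M.obj (.of X)) (n : N.obj (.of Y)) :
    (boxProd M N).obj (.of (X.prod Y)) :=
  ((SpanCat.prodFunctor G).leftKanExtensionUnit (externalProd M N)).app (.of X, .of Y) (m, n)

/-- The element `m ⊗ n = R_δ(m ⊠ n)` of `(M ⊠ N)(X)`, where `δ : X → X × X` is the diagonal. -/
noncomputable def tensorElt {X : FinGSet G} (m : M.obj (.of X)) (n : N.obj (.of X)) :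
    (boxProd M N).obj (.of X) :=
  (boxProd M N).map (SpanCat.homMk (GSpan.R X.diag)) (boxElt m n)

end Box

/-! ## Tambara functors -/

section Tambara

/-- The category of Tambara functors: product-preserving functors from the category of finite
`G`-sets and isomorphism classes of bispans to the category of sets. -/
abbrev TambaraFunctor (G : Type u) [Group G] :=
  ObjectProperty.FullSubcategory
    (fun S : BispanCat G ⥤ Type w => PreservesFiniteProducts S)

variable {G : Type u} [Group G]

/-- The empty `G`-set is terminal in the category of bispans. -/
def BispanCat.isTerminalEmpty : IsTerminal (BispanCat.of (FinGSet.empty G)) :=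
  IsTerminal.ofUniqueHom (fun X => BispanCat.homMk (Bispan.R (FinGSet.emptyMap X.set))) (by
    intro X f
    refine Quotient.inductionOn f fun s => Quotient.sound ?_
    have hB : ∀ b : s.B, False := fun b => PEmpty.elim (s.r b)
    exact ⟨⟨fun a => (hB (s.q a)).elim, fun a => PEmpty.elim a, fun a => (hB (s.q a)).elim,
        fun a => PEmpty.elim a⟩,
      ⟨fun b => (hB b).elim, fun a => PEmpty.elim a, fun b => (hB b).elim, fun a => PEmpty.elim a⟩,
      fun _ a => (hB (s.q a)).elim, fun _ b => (hB b).elim, fun a => (hB (s.q a)).elim,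
      fun a => (hB (s.q a)).elim, fun b => (hB b).elim⟩)

namespace TambaraFunctor

/-- The underlying Mackey functor of a Tambara functor, that is, the same sets with only the
transfers and the restrictions. -/
def toMackey (S : TambaraFunctor.{w} G) : SpanCat G ⥤ Type w := spanToBispan G ⋙ S.obj

/-- The norm map `N_f : S(X) → S(Y)` of an equivariant map `f : X → Y`. -/
def norm (S : TambaraFunctor.{w} G) {X Y : FinGSet G} (f : X →[G] Y) (x : S.obj.obj (.of X)) :
    S.obj.obj (.of Y) :=
  S.obj.map (BispanCat.homMk (Bispan.N f)) x

/-- For a Tambara functor `S`, the set `S(∅)` has exactly one element. -/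
noncomputable instance (S : TambaraFunctor.{w} G) :
    Unique (S.obj.obj (.of (FinGSet.empty G))) :=
  haveI := S.property
  Types.isTerminalEquivUnique _ (BispanCat.isTerminalEmpty.isTerminalObj S.obj _)

/-- The multiplicative identity `1 ∈ S(X)`, which is `N_z(∗)` where `z : ∅ → X` and `∗` is the
unique element of `S(∅)`. -/
noncomputable def one (S : TambaraFunctor.{w} G) (X : FinGSet G) : S.obj.obj (.of X) :=
  S.norm X.emptyMap default

end TambaraFunctor

/-- A functor from the category of bispans to sets with the same values on objects as `P`, and
which extends `P` along the functor from spans to bispans. -/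
@[ext]
structure BispanAction (P : SpanCat G ⥤ Type w) where
  map {X Y : FinGSet G} : (BispanCat.of X ⟶ BispanCat.of Y) → P.obj (.of X) → P.obj (.of Y)
  map_id {X : FinGSet G} (x : P.obj (.of X)) : map (𝟙 (BispanCat.of X)) x = x
  map_comp {X Y Z : FinGSet G} (f : BispanCat.of X ⟶ BispanCat.of Y)
    (g : BispanCat.of Y ⟶ BispanCat.of Z) (x : P.obj (.of X)) : map (f ≫ g) x = map g (map f x)
  map_span {X Y : FinGSet G} (f : SpanCat.of X ⟶ SpanCat.of Y) (x : P.obj (.of X)) :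
    map ((spanToBispan G).map f) x = P.map f x

/-- The functor from the category of bispans to sets given by a `BispanAction`. -/
def BispanAction.functor {P : SpanCat G ⥤ Type w} (T : BispanAction P) :
    BispanCat G ⥤ Type w where
  obj X := P.obj (.of X.set)
  map f := TypeCat.ofHom (T.map f)
  map_id X := by ext x; exact T.map_id x
  map_comp f g := by ext x; exact T.map_comp f g x

/-- A Tambara functor structure on a Mackey functor `P`: a product-preserving functor on the
category of bispans, with the same sets `P(X)`, transfers and restrictions as `P`. -/
structure TambaraStructure (P : SpanCat G ⥤ Type w) extends BispanAction P where
  preserves : PreservesFiniteProducts toBispanAction.functor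

namespace TambaraStructure

variable {P : SpanCat G ⥤ Type w}

/-- The resulting Tambara functor. -/
def toTambaraFunctor (T : TambaraStructure P) : TambaraFunctor.{w} G :=
  ⟨T.functor, T.preserves⟩

/-- The norm map `N_f : P(X) → P(Y)` of an equivariant map `f : X → Y`. -/
def norm (T : TambaraStructure P) {X Y : FinGSet G} (f : X →[G] Y) (x : P.obj (.of X)) :
    P.obj (.of Y) :=
  T.map (BispanCat.homMk (Bispan.N f)) x

end TambaraStructure

/-- The condition `N_f(m ⊗ n) = N_f(m) ⊗ N_f(n)` for a Tambara functor structure on `M ⊠ N`. -/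
def IsMultiplicativeNorm [Finite G] {M N : TambaraFunctor.{w} G}
    (T : TambaraStructure (boxProd M.toMackey N.toMackey)) : Prop :=
  ∀ ⦃X Y : FinGSet G⦄ (f : X →[G] Y) (m : M.obj.obj (.of X)) (n : N.obj.obj (.of X)),
    T.norm f (tensorElt (M := M.toMackey) (N := N.toMackey) m n) =
      tensorElt (M := M.toMackey) (N := N.toMackey) (M.norm f m) (N.norm f n)

end Tambara

/-!
Every element of `(M ⊠ N)(X)` has the form `T_f(m ⊗ n)` for a map `f : E → X` and elements
`m ∈ M(E)`, `n ∈ N(E)`. Because the left Kan extension is pointwise, a function on `(M ⊠ N)(X)` is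
the same as a function of the triples `(f, m, n)` which respects Frobenius reciprocity,
`T_h(m) ⊗ n = T_h(m ⊗ R_h(n))` and `m ⊗ T_h(n) = T_h(R_h(m) ⊗ n)`
(`SpanCat.exists_eq_map_tr_tensorElt`, `SpanCat.exists_lift`).

If the norms are multiplicative, then a bispan `X ← A → B → Y` with maps `p`, `q`, `r` has to send
`m ⊗ n` to `T_r(N_q R_p(m) ⊗ N_q R_p(n))`, which is called `bispanTens` below. Hence it sends
`T_f(m ⊗ n)` to the value of `bispanTens` at the composite of `T_f` with the bispan, and there is at
most one structure. For existence, this formula has to respect Frobenius reciprocity. The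
distributive law `exists_tr_comp` rewrites `N_q R_p T_h` as `T_k N_{q'} R_{p'}`; moreover the square
formed by `q'`, `q` and `k` is a pullback, so `N_{q'} R_{p'} R_h = R_k N_q R_p`. Thus Frobenius
reciprocity for `h` follows from Frobenius reciprocity for `k` (`bispanTens_tr_left`,
`bispanTens_tr_right`). Functoriality comes from `bispanTens_rs_nm`.

The functor so obtained preserves products: an element over `X ⊔ Y` is a juxtaposition of an element
over `X` and an element over `Y`, and juxtaposition with a fixed element is well defined by
Frobenius reciprocity (`exists_eq_map_sumMap`, `box_sum_ext`).

In a Tambara functor the norm along the fold map `X ⊔ X → X` is a commutative multiplication, which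
also satisfies Frobenius reciprocity (`tr_mul`). So morphisms `φ : M → S` and `ψ : N → S` induce
`T_f(m ⊗ n) ↦ T_f(φ(m) ψ(n))`, and this is the only possibility, since
`m ⊗ n = (m ⊗ 1)(1 ⊗ n)` (`mul_tens_one`).
-/

/-! ### Finite `G`-sets -/

namespace FinGSet

variable {G : Type u} [Group G]

/-- The disjoint union of two finite `G`-sets. -/
def sum (X Y : FinGSet G) : FinGSet G := ⟨X ⊕ Y⟩

/-- The inclusion of the first summand. -/
def inl (X Y : FinGSet G) : X →[G] X.sum Y where
  toFun := Sum.inl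
  map_smul' _ _ := rfl

/-- The inclusion of the second summand. -/
def inr (X Y : FinGSet G) : Y →[G] X.sum Y where
  toFun := Sum.inr
  map_smul' _ _ := rfl

/-- The map out of a disjoint union with given components. -/
def sumElim {X Y Z : FinGSet G} (f : X →[G] Z) (g : Y →[G] Z) : X.sum Y →[G] Z where
  toFun := Sum.elim f g
  map_smul' a x := by cases x <;> exact map_smul _ _ _

/-- The disjoint union of two equivariant maps. -/
def sumMap {X Y X' Y' : FinGSet G} (f : X →[G] X') (g : Y →[G] Y') :
    X.sum Y →[G] X'.sum Y' where
  toFun := Sum.map f g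
  map_smul' a x := by
    cases x
    · exact congrArg Sum.inl (map_smul f a _)
    · exact congrArg Sum.inr (map_smul g a _)

/-- The fibre product of two equivariant maps. -/
def pb {X Y Z : FinGSet G} (f : X →[G] Z) (g : Y →[G] Z) : FinGSet G :=
  ⟨GSpan.Pull (⟨X, f, f⟩ : GSpan Z Z) (⟨Y, g, g⟩ : GSpan Z Z)⟩

/-- The first projection of a fibre product. -/
def pbFst {X Y Z : FinGSet G} (f : X →[G] Z) (g : Y →[G] Z) : pb f g →[G] X where
  toFun a := a.1.1
  map_smul' _ _ := rfl

/-- The second projection of a fibre product. -/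
def pbSnd {X Y Z : FinGSet G} (f : X →[G] Z) (g : Y →[G] Z) : pb f g →[G] Y where
  toFun a := a.1.2
  map_smul' _ _ := rfl

/-- The square with top edge `b`, left edge `a`, bottom edge `f` and right edge `g` commutes, and is
a pullback of sets. -/
structure IsPb {P X Y Z : FinGSet G} (a : P →[G] X) (b : P →[G] Y) (f : X →[G] Z)
    (g : Y →[G] Z) : Prop where
  comm : ∀ p, f (a p) = g (b p)
  ex : ∀ x y, f x = g y → ∃ p, a p = x ∧ b p = y
  inj : ∀ p p', a p = a p' → b p = b p' → p = p'

variable {P X Y Z : FinGSet G}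

theorem IsPb.flip {a : P →[G] X} {b : P →[G] Y} {f : X →[G] Z} {g : Y →[G] Z}
    (h : IsPb a b f g) : IsPb b a g f where
  comm p := (h.comm p).symm
  ex x y e := (h.ex y x e.symm).imp fun _ => And.symm
  inj p p' e e' := h.inj p p' e' e

theorem IsPb.paste {X' Z' : FinGSet G} {a : P →[G] X} {b : P →[G] Y} {f : X →[G] Z}
    {g : Y →[G] Z} {c : Y →[G] X'} {d : Z →[G] Z'} {e : X' →[G] Z'} (h : IsPb a b f g)
    (h' : IsPb g c d e) : IsPb a (c.comp b) (d.comp f) e where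
  comm p := (congrArg d (h.comm p)).trans (h'.comm _)
  ex x y k := by
    obtain ⟨p, h1, rfl⟩ := h'.ex (f x) y k
    obtain ⟨p', rfl, rfl⟩ := h.ex x p h1.symm
    exact ⟨p', rfl, rfl⟩
  inj p p' k k' := by
    refine h.inj _ _ k (h'.inj _ _ ?_ k')
    rw [← h.comm, ← h.comm, k]

theorem isPb_pb (f : X →[G] Z) (g : Y →[G] Z) : IsPb (pbFst f g) (pbSnd f g) f g where
  comm p := p.2
  ex x y h := ⟨⟨(x, y), h⟩, rfl, rfl⟩
  inj _ _ h h' := Subtype.ext (Prod.ext h h')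

theorem isPb_inl (f : X →[G] Z) {W : FinGSet G} (g : Y →[G] W) :
    IsPb (inl X Y) f (sumMap f g) (inl Z W) where
  comm _ := rfl
  ex x y h := by
    rcases x with x | x
    · exact ⟨x, rfl, Sum.inl.inj h⟩
    · exact (Sum.inr_ne_inl h).elim
  inj _ _ h _ := Sum.inl.inj h

theorem isPb_inr (f : X →[G] Z) {W : FinGSet G} (g : Y →[G] W) :
    IsPb (inr X Y) g (sumMap f g) (inr Z W) where
  comm _ := rfl
  ex x y h := by
    rcases x with x | x
    · exact (Sum.inl_ne_inr h).elim
    · exact ⟨x, rfl, Sum.inr.inj h⟩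
  inj _ _ h _ := Sum.inr.inj h

/-- Since coproducts of sets are universal, a map to `X ⊔ Y` is the sum of its restrictions. -/
theorem bijective_sumElim {A A₁ A₂ : FinGSet G} {a₁ : A₁ →[G] A} {a₂ : A₂ →[G] A}
    {f : A →[G] X.sum Y} {f₁ : A₁ →[G] X} {f₂ : A₂ →[G] Y} (h₁ : IsPb a₁ f₁ f (inl X Y))
    (h₂ : IsPb a₂ f₂ f (inr X Y)) : Function.Bijective (sumElim a₁ a₂) := by
  constructor
  · have key : ∀ x y, a₁ x ≠ a₂ y := fun x y h =>
      Sum.inl_ne_inr ((h₁.comm x).symm.trans ((congrArg f h).trans (h₂.comm y)))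
    rintro (x | x) (y | y) h
    · exact congrArg Sum.inl (h₁.inj _ _ h
        (Sum.inl.inj ((h₁.comm x).symm.trans ((congrArg f h).trans (h₁.comm y)))))
    · exact (key x y h).elim
    · exact (key y x h.symm).elim
    · exact congrArg Sum.inr (h₂.inj _ _ h
        (Sum.inr.inj ((h₂.comm x).symm.trans ((congrArg f h).trans (h₂.comm y)))))
  · intro a
    rcases h : f a with x | y
    · obtain ⟨p, hp, -⟩ := h₁.ex a x h
      exact ⟨Sum.inl p, hp⟩
    · obtain ⟨p, hp, -⟩ := h₂.ex a y h
      exact ⟨Sum.inr p, hp⟩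

theorem isPb_inl_inr (X Y : FinGSet G) :
    IsPb (emptyMap X) (emptyMap Y) (inl X Y) (inr X Y) where
  comm p := PEmpty.elim p
  ex _ _ h := (Sum.inl_ne_inr h).elim
  inj p := PEmpty.elim p

theorem isPb_emptyMap (f : X →[G] Y) :
    IsPb (MulActionHom.id G) (emptyMap X) (emptyMap Y) f where
  comm p := PEmpty.elim p
  ex x := PEmpty.elim x
  inj p := PEmpty.elim p

theorem isPb_id_left (f : X →[G] Y) : IsPb (MulActionHom.id G) f f (MulActionHom.id G) where
  comm _ := rfl
  ex x _ h := ⟨x, rfl, h⟩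
  inj _ _ h _ := h

theorem isPb_id_of_injective (f : X →[G] Y) (hf : Function.Injective f) :
    IsPb (MulActionHom.id G) (MulActionHom.id G) f f where
  comm _ := rfl
  ex x _ h := ⟨x, rfl, hf h⟩
  inj _ _ h _ := h

end FinGSet

/-! ### The category of spans -/

namespace SpanCat

open FinGSet

variable {G : Type u} [Group G] {X Y Z W P : FinGSet G}

/-- The morphism `T_f` of spans. -/
def tr (f : X →[G] Y) : of X ⟶ of Y := homMk (GSpan.T f)

/-- The morphism `R_f` of spans. -/
def rs (f : X →[G] Y) : of Y ⟶ of X := homMk (GSpan.R f)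

theorem tr_id (X : FinGSet G) : tr (MulActionHom.id G : X →[G] X) = 𝟙 (of X) := rfl

theorem rs_id (X : FinGSet G) : rs (MulActionHom.id G : X →[G] X) = 𝟙 (of X) := rfl

/-- To compute the composite of two spans it is enough to give a pullback of the middle legs. -/
theorem comp_eq (s : GSpan X Y) (t : GSpan Y Z) (u : GSpan X Z) (a : u.A →[G] s.A)
    (b : u.A →[G] t.A) (h : IsPb a b s.q t.p) (hp : ∀ x, u.p x = s.p (a x))
    (hq : ∀ x, u.q x = t.q (b x)) : homMk s ≫ homMk t = homMk u := by
  refine Eq.symm (Quotient.sound ⟨Equiv.ofBijective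
    (fun x => (⟨(a x, b x), h.comm x⟩ : GSpan.Pull s t)) ⟨fun x y e => ?_, fun y => ?_⟩,
    fun g x => Subtype.ext (Prod.ext (map_smul a g x) (map_smul b g x)),
    fun x => (hp x).symm, fun x => (hq x).symm⟩)
  · have e' := congrArg Subtype.val e
    exact h.inj _ _ (congrArg Prod.fst e') (congrArg Prod.snd e')
  · obtain ⟨p, h1, h2⟩ := h.ex _ _ y.2
    exact ⟨p, Subtype.ext (Prod.ext h1 h2)⟩

theorem homMk_eq (s : GSpan X Y) : homMk s = rs s.p ≫ tr s.q :=
  (comp_eq (GSpan.R s.p) (GSpan.T s.q) s (MulActionHom.id G) (MulActionHom.id G)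
    (isPb_id_left (MulActionHom.id G)) (fun _ => rfl) (fun _ => rfl)).symm

theorem tr_comp (f : X →[G] Y) (g : Y →[G] Z) : tr f ≫ tr g = tr (g.comp f) :=
  comp_eq _ _ _ (MulActionHom.id G) f (isPb_id_left f) (fun _ => rfl) (fun _ => rfl)

theorem rs_comp (f : X →[G] Y) (g : Y →[G] Z) : rs g ≫ rs f = rs (g.comp f) :=
  comp_eq _ _ _ f (MulActionHom.id G) (isPb_id_left f).flip (fun _ => rfl) (fun _ => rfl)

theorem tr_rs {a : P →[G] X} {b : P →[G] Y} {f : X →[G] Z} {g : Y →[G] Z}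
    (h : IsPb a b f g) : tr f ≫ rs g = rs a ≫ tr b :=
  (comp_eq _ _ ⟨P, a, b⟩ a b h (fun _ => rfl) (fun _ => rfl)).trans (homMk_eq ⟨P, a, b⟩)

end SpanCat

/-! ### The category of bispans -/

namespace BispanCat

open FinGSet

variable {G : Type u} [Group G] {X Y Z W P : FinGSet G}

/-- The morphism `T_f` of bispans. -/
def tr (f : X →[G] Y) : of X ⟶ of Y := homMk (Bispan.T f)

/-- The morphism `N_f` of bispans. -/
def nm (f : X →[G] Y) : of X ⟶ of Y := homMk (Bispan.N f)

/-- The morphism `R_f` of bispans. -/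
def rs (f : X →[G] Y) : of Y ⟶ of X := homMk (Bispan.R f)

theorem tr_id (X : FinGSet G) : tr (MulActionHom.id G : X →[G] X) = 𝟙 (of X) := rfl

theorem nm_id (X : FinGSet G) : nm (MulActionHom.id G : X →[G] X) = 𝟙 (of X) := rfl

theorem rs_id (X : FinGSet G) : rs (MulActionHom.id G : X →[G] X) = 𝟙 (of X) := rfl

open Bispan in
/-- A criterion for computing the composite `s ≫ t`: over a point `b` of `B₁` the bispan `u` has to
consist of the maps `σ : q₁⁻¹{b} → B₀` over `X₁`. Here `ev` evaluates such a map at a point of the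
pullback `C` of `u.B` and `t.A` over `t.B`. -/
theorem comp_eq (s : Bispan X Y) (t : Bispan Y Z) (u : Bispan X Z) {C : FinGSet G}
    (k : u.B →[G] t.B) (c : C →[G] u.B) (d : C →[G] t.A) (ev : C →[G] s.B)
    (α : u.A →[G] s.A) (γ : u.A →[G] C)
    (hC : IsPb c d k t.q) (hev : ∀ x, s.r (ev x) = t.p (d x))
    (hA : IsPb γ α ev s.q)
    (hB : ∀ x y, k x = k y → (∀ z z', c z = x → c z' = y → d z = d z' → ev z = ev z') → x = y)
    (hB' : ∀ (b : t.B) (σ : {a : t.A // t.q a = b} → s.B), (∀ a, s.r (σ a) = t.p a.1) →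
      ∃ x, k x = b ∧ ∀ z (h : t.q (d z) = b), c z = x → ev z = σ ⟨d z, h⟩)
    (hp : ∀ x, u.p x = s.p (α x)) (hq : ∀ x, u.q x = c (γ x))
    (hr : ∀ x, u.r x = t.r (k x)) : homMk s ≫ homMk t = homMk u := by
  have exz : ∀ (x : u.B) (a : t.A), t.q a = k x → ∃ z, c z = x ∧ d z = a := fun x a h =>
    hC.ex x a h.symm
  choose z hz hz' using exz
  have zc : ∀ y (h : t.q (d y) = k (c y)), z (c y) (d y) h = y := fun y h =>
    hC.inj _ _ (hz _ _ _) (hz' _ _ _)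
  -- The map `σ` attached to `x` evaluates at `a` the point of `C` lying over `x` and `a`.
  let F : u.B → CompB s t := fun x =>
    { b := k x
      σ := fun a => ev (z x a.1 a.2)
      hσ := fun a => by rw [hev, hz'] }
  have Fσ : ∀ x y (h : t.q (d y) = k x), c y = x → (F x).σ ⟨d y, h⟩ = ev y := by
    rintro x y h rfl
    exact congrArg ev (zc y h)
  have Fsmul : ∀ (g : G) x, F (g • x) = g • F x := fun g x =>
    CompB.ext' (map_smul k g x) fun a hx hy => by
      obtain ⟨y, h1, rfl⟩ := hC.ex (g • x) a hx.symm
      rw [Fσ _ _ _ h1]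
      have h2 : c (g⁻¹ • y) = x := by rw [map_smul, h1, inv_smul_smul]
      have h3 : t.q (d (g⁻¹ • y)) = (F x).b := by rw [← hC.comm, h2]
      rw [CompB.smul_σ]
      rw [CompB.σ_congr (x := F x) rfl (map_smul d g⁻¹ y).symm _ h3, Fσ x _ h3 h2, map_smul,
        smul_inv_smul]
  have Finj : Function.Injective F := fun x y h =>
    hB x y (congrArg CompB.b h) fun w w' h1 h2 h3 => by
      have e1 : t.q (d w) = (F x).b := by rw [← hC.comm, h1]
      have e2 : t.q (d w') = (F y).b := by rw [← hC.comm, h2]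
      rw [← Fσ x w e1 h1, ← Fσ y w' e2 h2]
      exact CompB.σ_congr h h3 _ _
  have Fsurj : Function.Surjective F := fun y => by
    obtain ⟨x, h1, h2⟩ := hB' y.b y.σ y.hσ
    refine ⟨x, CompB.ext' h1 fun a hx hy => ?_⟩
    obtain ⟨w, h3, rfl⟩ := hC.ex x a hx.symm
    rw [Fσ x w hx h3]
    exact h2 w hy h3
  let A : u.A → CompA s t := fun x =>
    { base := F (u.q x)
      a₀ := α x
      a₁ := d (γ x)
      h₁ := by rw [← hC.comm, ← hq]
      h₀ := by rw [Fσ _ _ _ (hq x).symm, hA.comm] }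
  refine Eq.symm (Quotient.sound (isIsomorphic_of_bijective (s := u) (t := s.comp t) A F
    ⟨fun x y h => ?_, fun y => ?_⟩ ⟨Finj, Fsurj⟩
    (fun g x => CompA.ext' ?_ (map_smul α g x) ?_) Fsmul
    (fun x => (hp x).symm) (fun _ => rfl) (fun x => (hr x).symm)))
  · refine hA.inj _ _ (hC.inj _ _ ?_ (congrArg CompA.a₁ h)) (congrArg CompA.a₀ h)
    rw [← hq, ← hq]
    exact Finj (congrArg CompA.base h)
  · obtain ⟨x, hx⟩ := Fsurj y.base
    have hkx : k x = y.base.b := congrArg CompB.b hx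
    obtain ⟨w, h1, h2⟩ := hC.ex x y.a₁ (hkx.trans y.h₁.symm)
    have h3 : t.q (d w) = (F x).b := by rw [← hC.comm, h1]
    obtain ⟨v, h4, h5⟩ := hA.ex w y.a₀ (by
      rw [y.h₀, ← Fσ x w h3 h1]
      exact CompB.σ_congr hx h2 _ _)
    refine ⟨v, CompA.ext' ?_ h5 ?_⟩
    · change F (u.q v) = y.base
      rw [hq, h4, h1, hx]
    · change d (γ v) = y.a₁
      rw [h4, h2]
  · change F (u.q (g • x)) = g • F (u.q x)
    rw [map_smul, Fsmul]
  · change d (γ (g • x)) = g • d (γ x)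
    rw [map_smul, map_smul]

theorem comp_tr (s : Bispan X Y) (f : Y →[G] Z) :
    homMk s ≫ tr f = homMk ⟨s.A, s.B, s.p, s.q, f.comp s.r⟩ := by
  refine comp_eq s (Bispan.T f) _ (C := s.B) s.r (MulActionHom.id G) s.r (MulActionHom.id G)
    (MulActionHom.id G) s.q (isPb_id_left s.r) (fun _ => rfl) (isPb_id_left s.q).flip
    (fun x y h h' => h' x y rfl rfl h)
    (fun b σ hσ => ⟨σ ⟨b, rfl⟩, hσ ⟨b, rfl⟩, ?_⟩)
    (fun _ => rfl) (fun _ => rfl) (fun _ => rfl)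
  rintro z h rfl
  exact congrArg σ (Subtype.ext h.symm)

theorem rs_comp_homMk (f : X →[G] Y) (s : Bispan X Z) :
    rs f ≫ homMk s = homMk ⟨s.A, s.B, f.comp s.p, s.q, s.r⟩ :=
  comp_eq (Bispan.R f) s _ (C := s.A) (MulActionHom.id G) s.q (MulActionHom.id G) s.p
    s.p (MulActionHom.id G) (isPb_id_left s.q).flip (fun _ => rfl) (isPb_id_left s.p)
    (fun _ _ h _ => h) (fun b _ hσ => ⟨b, rfl, fun z h _ => (hσ ⟨z, h⟩).symm⟩)
    (fun _ => rfl) (fun _ => rfl) (fun _ => rfl)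

theorem comp_nm {A : FinGSet G} (p : A →[G] X) (q : A →[G] Y) (f : Y →[G] Z) :
    homMk ⟨A, Y, p, q, MulActionHom.id G⟩ ≫ nm f =
      homMk ⟨A, Z, p, f.comp q, MulActionHom.id G⟩ :=
  comp_eq ⟨A, Y, p, q, MulActionHom.id G⟩ (Bispan.N f)
    ⟨A, Z, p, f.comp q, MulActionHom.id G⟩ (C := Y) (MulActionHom.id G) f
    (MulActionHom.id G) (MulActionHom.id G) (MulActionHom.id G) q (isPb_id_left f).flip
    (fun _ => rfl) (isPb_id_left q).flip
    (fun _ _ h _ => h) (fun b _ hσ => ⟨b, rfl, fun z h _ => (hσ ⟨z, h⟩).symm⟩)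
    (fun _ => rfl) (fun _ => rfl) (fun _ => rfl)

/-- Restricting a bispan along `f` amounts to pulling back its last two sets. -/
theorem comp_rs (s : Bispan X Y) (f : Z →[G] Y) {A B : FinGSet G} (a : A →[G] s.A) (b : B →[G] s.B)
    (q : A →[G] B) (r : B →[G] Z) (hB : IsPb b r s.r f) (hA : IsPb a q s.q b) :
    homMk s ≫ rs f = homMk ⟨A, B, s.p.comp a, q, r⟩ := by
  refine comp_eq s (Bispan.R f) ⟨A, B, s.p.comp a, q, r⟩ (C := B) r (MulActionHom.id G) r b a q
    (isPb_id_left r) hB.comm hA.flip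
    (fun x y h h' => hB.inj _ _ (h' x y rfl rfl h) h) (fun c σ hσ => ?_)
    (fun _ => rfl) (fun _ => rfl) (fun _ => rfl)
  obtain ⟨x, h1, h2⟩ := hB.ex (σ ⟨c, rfl⟩) c (hσ ⟨c, rfl⟩)
  refine ⟨x, h2, ?_⟩
  rintro z h rfl
  obtain rfl : r z = c := h
  exact h1

theorem homMk_eq (s : Bispan X Y) : homMk s = rs s.p ≫ nm s.q ≫ tr s.r := by
  rw [show nm s.q ≫ tr s.r = homMk ⟨s.A, s.B, MulActionHom.id G, s.q, s.r⟩ from comp_tr _ _,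
    rs_comp_homMk]
  rfl

theorem hom_ind {C : (of X ⟶ of Y) → Prop}
    (h : ∀ (A B : FinGSet G) (p : A →[G] X) (q : A →[G] B) (r : B →[G] Y),
      C (rs p ≫ nm q ≫ tr r)) (f : of X ⟶ of Y) : C f :=
  Quotient.inductionOn f fun s => by
    have e := h _ _ s.p s.q s.r
    rwa [← homMk_eq] at e

theorem tr_comp (f : X →[G] Y) (g : Y →[G] Z) : tr f ≫ tr g = tr (g.comp f) := comp_tr _ _

theorem nm_comp (f : X →[G] Y) (g : Y →[G] Z) : nm f ≫ nm g = nm (g.comp f) := comp_nm _ _ _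

theorem rs_comp (f : X →[G] Y) (g : Y →[G] Z) : rs g ≫ rs f = rs (g.comp f) := rs_comp_homMk _ _

theorem tr_rs {a : P →[G] X} {b : P →[G] Y} {f : X →[G] Z} {g : Y →[G] Z}
    (h : IsPb a b f g) : tr f ≫ rs g = rs a ≫ tr b := by
  refine (comp_rs (Bispan.T f) g a a (MulActionHom.id G) b h (isPb_id_left a).flip).trans ?_
  exact (rs_comp_homMk a (Bispan.T b)).symm

theorem nm_rs {a : P →[G] X} {b : P →[G] Y} {f : X →[G] Z} {g : Y →[G] Z}
    (h : IsPb a b f g) : nm f ≫ rs g = rs a ≫ nm b := by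
  refine (comp_rs (Bispan.N f) g a g b (MulActionHom.id G) (isPb_id_left g).flip h).trans ?_
  exact (rs_comp_homMk a (Bispan.N b)).symm

open Bispan in
/-- The distributive law: a transfer followed by a restriction and a norm can be rewritten with the
transfer last. The new norm is the pullback of the given one along the new transfer. -/
theorem exists_tr_comp {A B : FinGSet G} (h : X →[G] Y) (p : A →[G] Y) (q : A →[G] B) :
    ∃ (A' B' : FinGSet G) (p' : A' →[G] X) (q' : A' →[G] B') (k : B' →[G] B) (a : A' →[G] A),
      tr h ≫ rs p ≫ nm q = rs p' ≫ nm q' ≫ tr k ∧ IsPb a q' q k ∧ h.comp p' = p.comp a := by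
  let s : Bispan X Y := T h
  let t : Bispan Y B := ⟨A, B, p, q, MulActionHom.id G⟩
  have e : ∀ x : CompA s t, h x.a₀ = p x.a₁ := fun x =>
    (congrArg h x.h₀).trans (x.base.hσ ⟨x.a₁, x.h₁⟩)
  refine ⟨(s.comp t).A, (s.comp t).B, (s.comp t).p, (s.comp t).q, (s.comp t).r,
    { toFun := fun x : CompA s t => x.a₁, map_smul' := fun _ _ => rfl }, ?_,
    ⟨fun x => CompA.h₁ x, fun x y hxy => ?_, fun x y h1 h2 => ?_⟩, MulActionHom.ext e⟩
  · rw [← homMk_eq, show rs p ≫ nm q = homMk t from rs_comp_homMk _ _]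
    rfl
  · exact ⟨(⟨y, CompB.σ y ⟨x, hxy⟩, x, hxy, rfl⟩ : CompA s t), rfl, rfl⟩
  · exact CompA.ext' h2 ((CompA.h₀ x).trans ((CompB.σ_congr h2 h1 _ _).trans (CompA.h₀ y).symm)) h1

/-! ### Products of bispans -/

/-- The disjoint union of two bispans with the same source. -/
def sumBispan (s : Bispan Z X) (t : Bispan Z Y) : Bispan Z (X.sum Y) :=
  ⟨s.A.sum t.A, s.B.sum t.B, sumElim s.p t.p, sumMap s.q t.q, sumMap s.r t.r⟩

/-- The morphism into `X ⊔ Y` with given components. -/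
def pairHom (f : of Z ⟶ of X) (g : of Z ⟶ of Y) : of Z ⟶ of (X.sum Y) :=
  Quotient.map₂ sumBispan (by
    rintro s s' ⟨α, β, hα, hβ, hp, hq, hr⟩ t t' ⟨α', β', hα', hβ', hp', hq', hr'⟩
    refine ⟨α.sumCongr α', β.sumCongr β', fun g a => ?_, fun g a => ?_, fun a => ?_, fun a => ?_,
      fun a => ?_⟩ <;> rcases a with a | a
    · exact congrArg Sum.inl (hα g a)
    · exact congrArg Sum.inr (hα' g a)
    · exact congrArg Sum.inl (hβ g a)
    · exact congrArg Sum.inr (hβ' g a)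
    · exact hp a
    · exact hp' a
    · exact congrArg Sum.inl (hq a)
    · exact congrArg Sum.inr (hq' a)
    · exact congrArg Sum.inl (hr a)
    · exact congrArg Sum.inr (hr' a)) f g

theorem pairHom_inl (f : of Z ⟶ of X) (g : of Z ⟶ of Y) : pairHom f g ≫ rs (inl X Y) = f := by
  induction f, g using Quotient.inductionOn₂ with | _ s t
  exact comp_rs (sumBispan s t) (inl X Y) (inl _ _) (inl _ _) s.q s.r (isPb_inl s.r t.r)
    (isPb_inl s.q t.q)

theorem pairHom_inr (f : of Z ⟶ of X) (g : of Z ⟶ of Y) : pairHom f g ≫ rs (inr X Y) = g := by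
  induction f, g using Quotient.inductionOn₂ with | _ s t
  exact comp_rs (sumBispan s t) (inr X Y) (inr _ _) (inr _ _) t.q t.r (isPb_inr s.r t.r)
    (isPb_inr s.q t.q)

theorem pairHom_eta (f : of Z ⟶ of (X.sum Y)) :
    pairHom (f ≫ rs (inl X Y)) (f ≫ rs (inr X Y)) = f := by
  induction f using Quotient.inductionOn with | _ s
  have hB₁ := isPb_pb s.r (inl X Y)
  have hB₂ := isPb_pb s.r (inr X Y)
  have hA₁ := isPb_pb s.q (pbFst s.r (inl X Y))
  have hA₂ := isPb_pb s.q (pbFst s.r (inr X Y))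
  have e₁ := comp_rs s (inl X Y) _ _ _ _ hB₁ hA₁
  have e₂ := comp_rs s (inr X Y) _ _ _ _ hB₂ hA₂
  refine (congrArg₂ pairHom e₁ e₂).trans ?_
  refine Quotient.sound (Bispan.isIsomorphic_of_bijective (s := sumBispan _ _) (t := s)
    (sumElim (pbFst _ _) (pbFst _ _)) (sumElim (pbFst _ _) (pbFst _ _))
    (bijective_sumElim (f := s.r.comp s.q) (hA₁.paste hB₁)
      (hA₂.paste hB₂))
    (bijective_sumElim hB₁ hB₂) (map_smul _) (map_smul _) ?_ ?_ ?_)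
  · rintro (a | a) <;> rfl
  · rintro (a | a)
    · exact hA₁.comm a
    · exact hA₂.comm a
  · rintro (a | a)
    · exact hB₁.comm a
    · exact hB₂.comm a

/-- The disjoint union is the product in the category of bispans. -/
def isLimitSum (X Y : FinGSet G) : IsLimit (BinaryFan.mk (rs (inl X Y)) (rs (inr X Y))) :=
  BinaryFan.isLimitMk (fun c => pairHom c.fst c.snd) (fun c => pairHom_inl _ _)
    (fun c => pairHom_inr _ _) (fun c m h₁ h₂ => by
      rw [← h₁, ← h₂]
      exact (pairHom_eta m).symm)

instance : HasFiniteProducts (BispanCat G) :=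
  have : HasTerminal (BispanCat G) := isTerminalEmpty.hasTerminal
  have : HasBinaryProducts (BispanCat G) :=
    have : ∀ X Y : BispanCat G, HasLimit (pair X Y) := fun X Y =>
      ⟨⟨_, isLimitSum X.set Y.set⟩⟩
    hasBinaryProducts_of_hasLimit_pair _
  hasFiniteProducts_of_has_binary_and_terminal

end BispanCat

/-! ### The box product of Mackey functors -/

namespace SpanCat

open FinGSet

variable {G : Type u} [Group G] {X Y Z W P : FinGSet G}

theorem rs_tr_of_bijective (f : X →[G] Y) (hf : Function.Bijective f) :
    rs f ≫ tr f = 𝟙 (of Y) := by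
  rw [← tr_rs (a := f) (b := f) (f := MulActionHom.id G) (g := MulActionHom.id G)
    ⟨fun _ => rfl, fun x y h => (hf.2 x).imp fun _ h' => ⟨h', h'.trans h⟩, fun _ _ h _ => hf.1 h⟩,
    tr_id, rs_id, Category.comp_id]

variable {M N : SpanCat G ⥤ Type w}

/-- The product of two morphisms of spans. -/
def prodHom {X Y X' Y' : FinGSet G} (f : of X ⟶ of X') (g : of Y ⟶ of Y') :
    of (X.prod Y) ⟶ of (X'.prod Y') :=
  (prodFunctor G).map (X := (of X, of Y)) (Y := (of X', of Y')) (f, g)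

theorem prodHom_rs_rs {X' Y' : FinGSet G} (f : X →[G] X') (g : Y →[G] Y') :
    prodHom (rs f) (rs g) = rs (prodMap f g) := rfl

theorem prodHom_tr_id {X' : FinGSet G} (f : X →[G] X') :
    prodHom (tr f) (𝟙 (of Y)) = tr (prodMap f (MulActionHom.id G)) := rfl

theorem prodHom_id_tr {X' : FinGSet G} (f : X →[G] X') :
    prodHom (𝟙 (of Y)) (tr f) = tr (prodMap (MulActionHom.id G) f) := rfl

/-- The first component of a map into a product. -/
def fstHom (f : X →[G] Y.prod Z) : X →[G] Y :=
  ⟨fun a => (f a).1, fun g a => congrArg Prod.fst (map_smul f g a)⟩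

/-- The second component of a map into a product. -/
def sndHom (f : X →[G] Y.prod Z) : X →[G] Z :=
  ⟨fun a => (f a).2, fun g a => congrArg Prod.snd (map_smul f g a)⟩

section BoxElt

variable [Finite G]

theorem boxElt_map {X Y X' Y' : FinGSet G} (f : of X ⟶ of X') (g : of Y ⟶ of Y')
    (m : M.obj (of X)) (n : N.obj (of Y)) :
    boxElt (M.map f m) (N.map g n) = (boxProd M N).map (prodHom f g) (boxElt m n) :=
  congrArg (fun k => TypeCat.Hom.hom k (m, n))
    (((prodFunctor G).leftKanExtensionUnit (externalProd M N)).naturality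
      (X := (of X, of Y)) (Y := (of X', of Y')) (f, g))

theorem tensorElt_def (m : M.obj (of X)) (n : N.obj (of X)) :
    tensorElt m n = (boxProd M N).map (rs X.diag) (boxElt m n) := rfl

theorem map_rs_tensorElt (f : X →[G] Y) (m : M.obj (of Y)) (n : N.obj (of Y)) :
    (boxProd M N).map (rs f) (tensorElt m n) = tensorElt (M.map (rs f) m) (N.map (rs f) n) := by
  rw [tensorElt_def, tensorElt_def, boxElt_map, prodHom_rs_rs,
    ← Functor.map_comp_apply, ← Functor.map_comp_apply,
    rs_comp, rs_comp]
  rfl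

/-- The image of `R_f(m) ⊠ R_g(n)` under `R_δ`, for maps `f` and `g` with the same source. -/
theorem tensorElt_rs_rs (f : X →[G] Y) (g : X →[G] Z) (m : M.obj (of Y)) (n : N.obj (of Z)) :
    tensorElt (M.map (rs f) m) (N.map (rs g) n) =
      (boxProd M N).map (rs ((prodMap f g).comp X.diag)) (boxElt m n) := by
  rw [tensorElt_def, boxElt_map, prodHom_rs_rs, ← Functor.map_comp_apply, rs_comp]

/-- Frobenius reciprocity in the first variable. -/
theorem map_tr_tensorElt_left (h : X →[G] Y) (m : M.obj (of X)) (n : N.obj (of Y)) :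
    (boxProd M N).map (tr h) (tensorElt m (N.map (rs h) n)) = tensorElt (M.map (tr h) m) n := by
  have e := tensorElt_rs_rs (N := N) (MulActionHom.id G) h m n
  have e' := boxElt_map (N := N) (tr h) (𝟙 (of Y)) m n
  rw [rs_id, Functor.map_id_apply] at e
  rw [prodHom_tr_id, Functor.map_id_apply] at e'
  rw [e, tensorElt_def, e', ← Functor.map_comp_apply, ← Functor.map_comp_apply, tr_rs (b := h)]
  exact ⟨fun x => rfl, fun x y h => ⟨x.1, Prod.ext rfl ((congrArg Prod.fst h).trans
    (congrArg Prod.snd h).symm), congrArg Prod.fst h⟩, fun x y h _ => congrArg Prod.fst h⟩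

/-- Frobenius reciprocity in the second variable. -/
theorem map_tr_tensorElt_right (h : X →[G] Y) (m : M.obj (of Y)) (n : N.obj (of X)) :
    (boxProd M N).map (tr h) (tensorElt (M.map (rs h) m) n) = tensorElt m (N.map (tr h) n) := by
  have e := tensorElt_rs_rs (M := M) h (MulActionHom.id G) m n
  have e' := boxElt_map (M := M) (𝟙 (of Y)) (tr h) m n
  rw [rs_id, Functor.map_id_apply] at e
  rw [prodHom_id_tr, Functor.map_id_apply] at e'
  rw [e, tensorElt_def, e', ← Functor.map_comp_apply, ← Functor.map_comp_apply, tr_rs (b := h)]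
  exact ⟨fun x => rfl, fun x y h => ⟨x.2, Prod.ext ((congrArg Prod.snd h).trans
    (congrArg Prod.fst h).symm) rfl, congrArg Prod.snd h⟩, fun x y h _ => congrArg Prod.snd h⟩

/-- The universal cocone which computes the value of the box product at a finite `G`-set. -/
noncomputable def isColimitBoxProd (M N : SpanCat G ⥤ Type w) (X : SpanCat G) :
    IsColimit ((Functor.LeftExtension.mk ((prodFunctor G).leftKanExtension (externalProd M N))
      ((prodFunctor G).leftKanExtensionUnit (externalProd M N))).coconeAt X) :=
  have : EssentiallySmall.{w} (SpanCat G × SpanCat G) :=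
    ⟨_, inferInstance, ⟨(equivSmallModel.{w} (SpanCat G)).prod (equivSmallModel.{w} (SpanCat G))⟩⟩
  have (X : SpanCat G) : HasColimitsOfShape (CostructuredArrow (SpanCat.prodFunctor G) X)
    (Type w) := hasColimitsOfShape_of_essentiallySmall.{w} _ _
  Functor.isPointwiseLeftKanExtensionOfIsLeftKanExtension
    ((prodFunctor G).leftKanExtension (externalProd M N))
    ((prodFunctor G).leftKanExtensionUnit (externalProd M N)) X

theorem map_homMk_boxElt (s : GSpan (Y.prod Z) X) (m : M.obj (of Y)) (n : N.obj (of Z)) :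
    (boxProd M N).map (homMk s) (boxElt m n) = (boxProd M N).map (tr s.q)
      (tensorElt (M.map (rs (fstHom s.p)) m) (N.map (rs (sndHom s.p)) n)) := by
  rw [tensorElt_rs_rs, ← Functor.map_comp_apply, homMk_eq]
  rfl

/-- Every element of the box product has the form `T_f(m ⊗ n)`. -/
theorem exists_eq_map_tr_tensorElt (x : (boxProd M N).obj (of X)) :
    ∃ (E : FinGSet G) (f : E →[G] X) (m : M.obj (of E)) (n : N.obj (of E)),
      x = (boxProd M N).map (tr f) (tensorElt m n) := by
  obtain ⟨⟨⟨⟨U⟩, ⟨V⟩⟩, _, ω⟩, ⟨m, n⟩, rfl⟩ :=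
    Types.jointly_surjective_of_isColimit (isColimitBoxProd M N (of X)) x
  obtain ⟨s, rfl⟩ := Quotient.exists_rep ω
  exact ⟨s.A, s.q, _, _, map_homMk_boxElt (M := M) (N := N) s m n⟩

end BoxElt

section Lift

variable {S : Type w} (φ : ∀ {E : FinGSet G}, (E →[G] X) → M.obj (of E) → N.obj (of E) → S)
  (hl : ∀ {E E' : FinGSet G} (h : E' →[G] E) (f : E →[G] X) (m : M.obj (of E'))
    (n : N.obj (of E)), φ (f.comp h) m (N.map (rs h) n) = φ f (M.map (tr h) m) n)
  (hr : ∀ {E E' : FinGSet G} (h : E' →[G] E) (f : E →[G] X) (m : M.obj (of E))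
    (n : N.obj (of E')), φ (f.comp h) (M.map (rs h) m) n = φ f m (N.map (tr h) n))

include hl in
/-- By Frobenius reciprocity `φ` is invariant under isomorphisms of `E`. -/
theorem map_rs_rs_of_bijective {E E' : FinGSet G} (e : E' →[G] E) (he : Function.Bijective e)
    (f : E →[G] X) (m : M.obj (of E)) (n : N.obj (of E)) :
    φ (f.comp e) (M.map (rs e) m) (N.map (rs e) n) = φ f m n := by
  rw [hl, ← Functor.map_comp_apply, rs_tr_of_bijective e he, Functor.map_id_apply]

/-- The leg of the cocone with vertex `S` determined by `φ`: at a span `Y × Z ← A → X` with maps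
`(p₁, p₂)` and `q` it sends `(m, n)` to `φ q (R_{p₁} m) (R_{p₂} n)`. -/
def liftLeg (ω : of (Y.prod Z) ⟶ of X) (m : M.obj (of Y)) (n : N.obj (of Z)) : S :=
  Quotient.lift (fun s : GSpan (Y.prod Z) X =>
    φ s.q (M.map (rs (fstHom s.p)) m) (N.map (rs (sndHom s.p)) n)) (by
    rintro s t ⟨e, he, hp, hq⟩
    let e' : s.A →[G] t.A := ⟨e, he⟩
    have h1 : s.q = t.q.comp e' := MulActionHom.ext fun a => (hq a).symm
    have h2 : s.p = t.p.comp e' := MulActionHom.ext fun a => (hp a).symm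
    have h3 : fstHom s.p = (fstHom t.p).comp e' := by rw [h2]; rfl
    have h4 : sndHom s.p = (sndHom t.p).comp e' := by rw [h2]; rfl
    simp only [h1, h3, h4, ← rs_comp, Functor.map_comp_apply]
    exact map_rs_rs_of_bijective φ hl e' e.bijective _ _ _) ω

include hr in
/-- The functions `liftLeg φ hl ω` form a cocone. -/
theorem liftLeg_prodHom {Y' Z' : FinGSet G} (α : of Y ⟶ of Y') (β : of Z ⟶ of Z')
    (ω : of (Y'.prod Z') ⟶ of X) (m : M.obj (of Y)) (n : N.obj (of Z)) :
    liftLeg φ hl (prodHom α β ≫ ω) m n = liftLeg φ hl ω (M.map α m) (N.map β n) := by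
  obtain ⟨s, rfl⟩ := Quotient.exists_rep α
  obtain ⟨t, rfl⟩ := Quotient.exists_rep β
  obtain ⟨v, rfl⟩ := Quotient.exists_rep ω
  -- The middle set of the composite span is the fibre product over `v.A` of the pullbacks of `s.A`
  -- and `t.A` along the two components of `v.p`.
  have h₁ := isPb_pb s.q (fstHom v.p)
  have h₂ := isPb_pb t.q (sndHom v.p)
  set a₁ := pbFst s.q (fstHom v.p)
  set b₁ := pbSnd s.q (fstHom v.p)
  set a₂ := pbFst t.q (sndHom v.p)
  set b₂ := pbSnd t.q (sndHom v.p)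
  have h₃ := isPb_pb b₁ b₂
  set k₁ := pbFst b₁ b₂
  set k₂ := pbSnd b₁ b₂
  have e : prodHom (homMk s) (homMk t) ≫ homMk v = homMk ⟨pb b₁ b₂,
      (prodMap (s.p.comp (a₁.comp k₁)) (t.p.comp (a₂.comp k₂))).comp (diag _),
      v.q.comp (b₁.comp k₁)⟩ := by
    refine comp_eq (s.prod t) v _ ((prodMap (a₁.comp k₁) (a₂.comp k₂)).comp (diag _))
      (b₁.comp k₁) ⟨fun p => ?_, fun x y h => ?_, fun p p' h h' => ?_⟩ (fun _ => rfl)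
      (fun _ => rfl)
    · refine Prod.ext (h₁.comm _) ((h₂.comm _).trans (congrArg (sndHom v.p) (h₃.comm p).symm))
    · obtain ⟨p₁, h4, h5⟩ := h₁.ex x.1 y (congrArg Prod.fst h)
      obtain ⟨p₂, h6, h7⟩ := h₂.ex x.2 y (congrArg Prod.snd h)
      obtain ⟨p, h8, h9⟩ := h₃.ex p₁ p₂ (h5.trans h7.symm)
      subst h8 h9
      exact ⟨p, Prod.ext h4 h6, h5⟩
    · have h4 : a₁ (k₁ p) = a₁ (k₁ p') := (Prod.mk.inj h).1
      have h5 : a₂ (k₂ p) = a₂ (k₂ p') := (Prod.mk.inj h).2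
      have h6 : b₂ (k₂ p) = b₂ (k₂ p') := by rw [← h₃.comm, ← h₃.comm]; exact h'
      exact h₃.inj _ _ (h₁.inj _ _ h4 h') (h₂.inj _ _ h5 h6)
  -- The two transfers on the right-hand side are moved to the first argument of `φ`, one after the
  -- other, by means of `hl` and `hr`.
  have e' : prodHom (X := Y) (Y := Z) ⟦s⟧ ⟦t⟧ ≫ (⟦v⟧ : of _ ⟶ of X) = _ := e
  rw [e']
  change φ (v.q.comp (b₁.comp k₁)) (M.map (rs (s.p.comp (a₁.comp k₁))) m)
    (N.map (rs (t.p.comp (a₂.comp k₂))) n) = φ v.q (M.map (rs (fstHom v.p)) (M.map (homMk s) m))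
    (N.map (rs (sndHom v.p)) (N.map (homMk t) n))
  rw [homMk_eq s, homMk_eq t, ← Functor.map_comp_apply, ← Functor.map_comp_apply, Category.assoc,
    Category.assoc, tr_rs h₁, tr_rs h₂, ← Category.assoc, ← Category.assoc, rs_comp, rs_comp,
    Functor.map_comp_apply, Functor.map_comp_apply, ← hl, ← N.map_comp_apply (tr b₂),
    tr_rs h₃.flip, Functor.map_comp_apply, ← hr, ← Functor.map_comp_apply,
    ← Functor.map_comp_apply, rs_comp, rs_comp]
  rfl

include hl hr in
/-- A family of functions on `M(E) × N(E)`, indexed by the maps `E → X`, which satisfies Frobenius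
reciprocity in both variables factors through the box product. -/
theorem exists_lift [Finite G] : ∃ Φ : (boxProd M N).obj (of X) → S,
    ∀ {E : FinGSet G} (f : E →[G] X) (m : M.obj (of E)) (n : N.obj (of E)),
      Φ ((boxProd M N).map (tr f) (tensorElt m n)) = φ f m n := by
  let c : Cocone (CostructuredArrow.proj (prodFunctor G) (of X) ⋙ externalProd M N) :=
    { pt := S
      ι :=
        { app := fun j => TypeCat.ofHom fun x =>
            liftLeg (M := M) (N := N) (Y := j.left.1.set) (Z := j.left.2.set) φ hl j.hom x.1 x.2
          naturality := fun j j' f => by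
            ext x
            have e : prodHom f.left.1 f.left.2 ≫ j'.hom = j.hom := CostructuredArrow.w f
            refine (liftLeg_prodHom φ hl hr f.left.1 f.left.2 j'.hom x.1 x.2).symm.trans ?_
            rw [e]
            rfl } }
  refine ⟨TypeCat.Hom.hom ((isColimitBoxProd M N (of X)).desc c), fun {E} f m n => ?_⟩
  have h := congrArg (fun k => TypeCat.Hom.hom k (m, n)) ((isColimitBoxProd M N (of X)).fac c
    (CostructuredArrow.mk (S := prodFunctor G) (Y := (of E, of E)) (rs E.diag ≫ tr f)))
  have e : (boxProd M N).map (rs E.diag ≫ tr f) (boxElt m n) =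
      (boxProd M N).map (tr f) (tensorElt m n) := Functor.map_comp_apply _ _ _ _
  rw [← e]
  refine h.trans ?_
  have e' : rs E.diag ≫ tr f = homMk ⟨E, E.diag, f⟩ := (homMk_eq ⟨E, E.diag, f⟩).symm
  change liftLeg φ hl (rs E.diag ≫ tr f) m n = _
  rw [e']
  change φ f (M.map (rs (MulActionHom.id G)) m) (N.map (rs (MulActionHom.id G)) n) = _
  rw [rs_id, Functor.map_id_apply, Functor.map_id_apply]

end Lift

end SpanCat

/-! ### Multiplication in a Tambara functor -/

namespace BispanCat

open FinGSet

variable {G : Type u} [Group G] {X Y Z : FinGSet G}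

/-- A functor on bispans preserves finite products as soon as it is bijective on the products given
by the disjoint union and the empty set. -/
theorem preservesFiniteProducts_of_bijective (F : BispanCat G ⥤ Type w)
    (h₀ : Nonempty (Unique (F.obj (of (empty G)))))
    (hs : ∀ {X Y : FinGSet G} (x : F.obj (of X)) (y : F.obj (of Y)),
      ∃ z : F.obj (of (X.sum Y)), F.map (rs (inl X Y)) z = x ∧ F.map (rs (inr X Y)) z = y)
    (hi : ∀ {X Y : FinGSet G} (z z' : F.obj (of (X.sum Y))),
      F.map (rs (inl X Y)) z = F.map (rs (inl X Y)) z' →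
      F.map (rs (inr X Y)) z = F.map (rs (inr X Y)) z' → z = z') :
    PreservesFiniteProducts F := by
  have : ∀ X Y : BispanCat G, PreservesLimit (pair X Y) F := fun X Y => by
    refine preservesLimit_of_preserves_limit_cone (isLimitSum X.set Y.set)
      ((isLimitMapConeBinaryFanEquiv F _ _).symm ?_)
    choose d hd hd' using hs (X := X.set) (Y := Y.set)
    refine BinaryFan.isLimitMk (fun c => TypeCat.ofHom fun x => d (c.fst x) (c.snd x))
      (fun c => ?_) (fun c => ?_) (fun c m h₁ h₂ => ?_)
    · ext x
      exact hd _ _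
    · ext x
      exact hd' _ _
    · ext x
      refine hi _ _ ?_ ?_
      · exact (congrArg (fun k => TypeCat.Hom.hom k x) h₁).trans (hd _ _).symm
      · exact (congrArg (fun k => TypeCat.Hom.hom k x) h₂).trans (hd' _ _).symm
  have : PreservesLimitsOfShape (Discrete WalkingPair) F :=
    ⟨fun {K} => preservesLimit_of_iso_diagram F (diagramIsoPair K).symm⟩
  have : PreservesLimit (Functor.empty.{0} (BispanCat G)) F :=
    preservesLimit_of_preserves_limit_cone (isTerminalEmpty (G := G))
      ((isLimitMapConeEmptyConeEquiv F _).symm ((Types.isTerminalEquivUnique _).symm h₀.some))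
  have : PreservesLimitsOfShape (Discrete PEmpty.{1}) F :=
    preservesLimitsOfShape_pempty_of_preservesTerminal F
  exact PreservesFiniteProducts.of_preserves_binary_and_terminal F

end BispanCat

namespace FinGSet

variable {G : Type u} [Group G]

/-- The fold map `X ⊔ X → X`. -/
def fold (X : FinGSet G) : X.sum X →[G] X := sumElim (MulActionHom.id G) (MulActionHom.id G)

/-- The map exchanging the two summands. -/
def swap (X Y : FinGSet G) : X.sum Y →[G] Y.sum X := sumElim (inr Y X) (inl Y X)

theorem isPb_fold {X Y : FinGSet G} (f : X →[G] Y) :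
    IsPb (sumMap f f) (fold X) (fold Y) f where
  comm p := by cases p <;> rfl
  ex x y h := by
    rcases x with x | x
    · exact ⟨Sum.inl y, congrArg Sum.inl h.symm, rfl⟩
    · exact ⟨Sum.inr y, congrArg Sum.inr h.symm, rfl⟩
  inj p p' h h' := by
    rcases p with p | p <;> rcases p' with p' | p'
    · exact congrArg Sum.inl h'
    · exact (Sum.inl_ne_inr h).elim
    · exact (Sum.inr_ne_inl h).elim
    · exact congrArg Sum.inr h'

theorem isPb_swap_inl (X Y : FinGSet G) :
    IsPb (inr X Y) (MulActionHom.id G) (swap X Y) (inl Y X) where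
  comm _ := rfl
  ex x y h := by
    rcases x with x | x
    · exact (Sum.inr_ne_inl h).elim
    · exact ⟨x, rfl, Sum.inl.inj h⟩
  inj _ _ _ h := h

theorem isPb_swap_inr (X Y : FinGSet G) :
    IsPb (inl X Y) (MulActionHom.id G) (swap X Y) (inr Y X) where
  comm _ := rfl
  ex x y h := by
    rcases x with x | x
    · exact ⟨x, rfl, Sum.inr.inj h⟩
    · exact (Sum.inl_ne_inr h).elim
  inj _ _ _ h := h

end FinGSet

namespace BispanCat

open FinGSet

variable {G : Type u} [Group G] {X Y Z : FinGSet G}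

/-- The distributive law which underlies Frobenius reciprocity in a Tambara functor. -/
theorem tr_nm_fold (h : X →[G] Y) :
    tr (sumMap h (MulActionHom.id G : Y →[G] Y)) ≫ nm (fold Y) =
      rs (sumMap (MulActionHom.id G) h) ≫ nm (fold X) ≫ tr h := by
  refine (comp_eq (Bispan.T (sumMap h (MulActionHom.id G : Y →[G] Y))) (Bispan.N (fold Y))
    ⟨X.sum X, X, sumMap (MulActionHom.id G) h, fold X, h⟩ (C := X.sum X) h (fold X)
    (sumMap h h) (sumMap (MulActionHom.id G) h) (sumMap (MulActionHom.id G) h) (MulActionHom.id G)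
    (isPb_fold h).flip ?_ (isPb_id_left _) (fun x y _ k => ?_) (fun b σ hσ => ?_) (fun _ => rfl)
    (fun _ => rfl) (fun _ => rfl)).trans (homMk_eq _)
  · rintro (x | x) <;> rfl
  · exact Sum.inl.inj (k (Sum.inl x) (Sum.inl y) rfl rfl (congrArg Sum.inl ‹h x = h y›))
  · have h₁ := hσ ⟨Sum.inl b, rfl⟩
    rcases e₁ : σ ⟨Sum.inl b, rfl⟩ with x | x
    · rw [e₁] at h₁
      obtain rfl : h x = b := Sum.inl.inj h₁
      refine ⟨x, rfl, ?_⟩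
      rintro (z | z) hz rfl
      · exact e₁.symm
      · have h₂ := hσ ⟨Sum.inr (h z), hz⟩
        rcases e₂ : σ ⟨Sum.inr (h z), hz⟩ with y | y
        · rw [e₂] at h₂
          exact (Sum.inl_ne_inr h₂).elim
        · rw [e₂] at h₂
          obtain rfl : y = h z := Sum.inr.inj h₂
          exact e₂.symm
    · rw [e₁] at h₁
      exact (Sum.inr_ne_inl h₁).elim

end BispanCat

namespace TambaraFunctor

open FinGSet BispanCat

variable {G : Type u} [Group G] (S : TambaraFunctor.{w} G) {X Y Z W : FinGSet G}

/-- A Tambara functor sends disjoint unions to products. -/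
noncomputable def isLimitSum (X Y : FinGSet G) :
    IsLimit (BinaryFan.mk (S.obj.map (rs (inl X Y))) (S.obj.map (rs (inr X Y)))) :=
  haveI := S.property
  mapIsLimitOfPreservesOfIsLimit S.obj _ _ (BispanCat.isLimitSum X Y)

variable {S}

theorem exists_pair (x : S.obj.obj (.of X)) (y : S.obj.obj (.of Y)) :
    ∃ z : S.obj.obj (.of (X.sum Y)),
      S.obj.map (rs (inl X Y)) z = x ∧ S.obj.map (rs (inr X Y)) z = y := by
  let c := (Types.binaryProductCone (S.obj.obj (.of X)) (S.obj.obj (.of Y)))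
  refine ⟨(S.isLimitSum X Y).lift c (x, y), ?_, ?_⟩
  · exact congrArg (fun k => TypeCat.Hom.hom k (x, y)) ((S.isLimitSum X Y).fac c ⟨.left⟩)
  · exact congrArg (fun k => TypeCat.Hom.hom k (x, y)) ((S.isLimitSum X Y).fac c ⟨.right⟩)

/-- The element of `S(X ⊔ Y)` with given restrictions to `X` and `Y`. -/
noncomputable def pair (x : S.obj.obj (.of X)) (y : S.obj.obj (.of Y)) :
    S.obj.obj (.of (X.sum Y)) := (exists_pair x y).choose

@[simp]
theorem rs_inl_pair (x : S.obj.obj (.of X)) (y : S.obj.obj (.of Y)) :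
    S.obj.map (rs (inl X Y)) (pair x y) = x := (exists_pair x y).choose_spec.1

@[simp]
theorem rs_inr_pair (x : S.obj.obj (.of X)) (y : S.obj.obj (.of Y)) :
    S.obj.map (rs (inr X Y)) (pair x y) = y := (exists_pair x y).choose_spec.2

/-- An element of `S(X ⊔ Y)` is determined by its restrictions to `X` and `Y`. -/
theorem sum_ext {z z' : S.obj.obj (.of (X.sum Y))}
    (h₁ : S.obj.map (rs (inl X Y)) z = S.obj.map (rs (inl X Y)) z')
    (h₂ : S.obj.map (rs (inr X Y)) z = S.obj.map (rs (inr X Y)) z') : z = z' := by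
  have h := BinaryFan.IsLimit.hom_ext (S.isLimitSum X Y)
    (f := TypeCat.ofHom fun _ : PUnit.{w + 1} => z) (g := TypeCat.ofHom fun _ => z')
    (by ext; exact h₁) (by ext; exact h₂)
  exact congrArg (fun k => TypeCat.Hom.hom k PUnit.unit) h

theorem pair_eta (z : S.obj.obj (.of (X.sum Y))) :
    pair (S.obj.map (rs (inl X Y)) z) (S.obj.map (rs (inr X Y)) z) = z :=
  sum_ext (by simp) (by simp)

theorem tr_pair (f : X →[G] Z) (g : Y →[G] W) (x : S.obj.obj (.of X)) (y : S.obj.obj (.of Y)) :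
    S.obj.map (tr (sumMap f g)) (pair x y) = pair (S.obj.map (tr f) x) (S.obj.map (tr g) y) := by
  refine sum_ext ?_ ?_
  · rw [← Functor.map_comp_apply, tr_rs (isPb_inl f g), Functor.map_comp_apply]
    simp
  · rw [← Functor.map_comp_apply, tr_rs (isPb_inr f g), Functor.map_comp_apply]
    simp

theorem nm_pair (f : X →[G] Z) (g : Y →[G] W) (x : S.obj.obj (.of X)) (y : S.obj.obj (.of Y)) :
    S.obj.map (nm (sumMap f g)) (pair x y) = pair (S.obj.map (nm f) x) (S.obj.map (nm g) y) := by
  refine sum_ext ?_ ?_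
  · rw [← Functor.map_comp_apply, nm_rs (isPb_inl f g), Functor.map_comp_apply]
    simp
  · rw [← Functor.map_comp_apply, nm_rs (isPb_inr f g), Functor.map_comp_apply]
    simp

theorem rs_pair (f : X →[G] Z) (g : Y →[G] W) (x : S.obj.obj (.of Z)) (y : S.obj.obj (.of W)) :
    S.obj.map (rs (sumMap f g)) (pair x y) = pair (S.obj.map (rs f) x) (S.obj.map (rs g) y) := by
  refine sum_ext ?_ ?_
  · rw [← Functor.map_comp_apply, rs_comp, rs_inl_pair,
      show (sumMap f g).comp (inl X Y) = (inl Z W).comp f from rfl, ← rs_comp,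
      Functor.map_comp_apply, rs_inl_pair]
  · rw [← Functor.map_comp_apply, rs_comp, rs_inr_pair,
      show (sumMap f g).comp (inr X Y) = (inr Z W).comp g from rfl, ← rs_comp,
      Functor.map_comp_apply, rs_inr_pair]

/-- The product of two elements of `S(X)`: the norm along the fold map `X ⊔ X → X`. -/
noncomputable def mul (x y : S.obj.obj (.of X)) : S.obj.obj (.of X) :=
  S.obj.map (nm (fold X)) (pair x y)

theorem rs_mul (f : X →[G] Y) (x y : S.obj.obj (.of Y)) :
    S.obj.map (rs f) (mul x y) = mul (S.obj.map (rs f) x) (S.obj.map (rs f) y) := by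
  rw [mul, mul, ← Functor.map_comp_apply, nm_rs (isPb_fold f), Functor.map_comp_apply, rs_pair]

theorem nm_mul (f : X →[G] Y) (x y : S.obj.obj (.of X)) :
    S.obj.map (nm f) (mul x y) = mul (S.obj.map (nm f) x) (S.obj.map (nm f) y) := by
  have e : f.comp (fold X) = (fold Y).comp (sumMap f f) := MulActionHom.ext fun x => by
    cases x <;> rfl
  rw [mul, mul, ← Functor.map_comp_apply, nm_comp, e, ← nm_pair, ← Functor.map_comp_apply, nm_comp]

theorem mul_comm (x y : S.obj.obj (.of X)) : mul x y = mul y x := by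
  have e : pair y x = S.obj.map (nm (swap X X)) (pair x y) := by
    refine sum_ext ?_ ?_
    · rw [← Functor.map_comp_apply, nm_rs (isPb_swap_inl X X), nm_id, Category.comp_id]
      simp
    · rw [← Functor.map_comp_apply, nm_rs (isPb_swap_inr X X), nm_id, Category.comp_id]
      simp
  have e' : (fold X).comp (swap X X) = fold X := MulActionHom.ext fun x => by cases x <;> rfl
  rw [mul, mul, e, ← Functor.map_comp_apply, nm_comp, e']

/-- Frobenius reciprocity. -/
theorem tr_mul (h : X →[G] Y) (x : S.obj.obj (.of X)) (y : S.obj.obj (.of Y)) :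
    mul (S.obj.map (tr h) x) y = S.obj.map (tr h) (mul x (S.obj.map (rs h) y)) := by
  have e : pair (S.obj.map (tr h) x) y =
      S.obj.map (tr (sumMap h (MulActionHom.id G))) (pair x y) := by
    rw [tr_pair, tr_id, Functor.map_id_apply]
  have e' : pair x (S.obj.map (rs h) y) =
      S.obj.map (rs (sumMap (MulActionHom.id G) h)) (pair x y) := by
    rw [rs_pair, rs_id, Functor.map_id_apply]
  rw [mul, mul, e, e', ← Functor.map_comp_apply, tr_nm_fold, Functor.map_comp_apply,
    Functor.map_comp_apply]

theorem mul_tr (h : X →[G] Y) (x : S.obj.obj (.of Y)) (y : S.obj.obj (.of X)) :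
    mul x (S.obj.map (tr h) y) = S.obj.map (tr h) (mul (S.obj.map (rs h) x) y) := by
  rw [mul_comm, tr_mul, mul_comm]

theorem one_def (X : FinGSet G) : S.one X = S.obj.map (nm (emptyMap X)) default := rfl

theorem rs_one (f : X →[G] Y) : S.obj.map (rs f) (S.one Y) = S.one X := by
  rw [one_def, ← Functor.map_comp_apply, nm_rs (isPb_emptyMap f), rs_id, Category.id_comp]
  rfl

theorem nm_one (f : X →[G] Y) : S.obj.map (nm f) (S.one X) = S.one Y := by
  rw [one_def, ← Functor.map_comp_apply, nm_comp,
    show f.comp (emptyMap X) = emptyMap Y from MulActionHom.ext fun x => PEmpty.elim x]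
  rfl

theorem pair_one (x : S.obj.obj (.of X)) : pair x (S.one Y) = S.obj.map (nm (inl X Y)) x := by
  refine sum_ext ?_ ?_
  · rw [← Functor.map_comp_apply, nm_rs (isPb_id_of_injective (inl X Y) Sum.inl_injective)]
    simp [nm_id, rs_id]
  · rw [← Functor.map_comp_apply, nm_rs (isPb_inl_inr X Y), Functor.map_comp_apply, rs_inr_pair,
      one_def]
    exact congrArg _ (Subsingleton.elim _ _)

theorem mul_one (x : S.obj.obj (.of X)) : mul x (S.one X) = x := by
  rw [mul, pair_one, ← Functor.map_comp_apply, nm_comp]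
  exact Functor.map_id_apply _ _ _

theorem one_mul (x : S.obj.obj (.of X)) : mul (S.one X) x = x := by
  rw [mul_comm, mul_one]

/-- In a Tambara functor `N_q R_p T_h = T_k N_{q'} R_{p'}` and `N_{q'} R_{p'} R_h = R_k N_q R_p`,
for the same `k`, `p'` and `q'`. -/
theorem exists_nm_tr {A B : FinGSet G} (h : X →[G] Y) (p : A →[G] Y) (q : A →[G] B) :
    ∃ (A' B' : FinGSet G) (p' : A' →[G] X) (q' : A' →[G] B') (k : B' →[G] B),
      (∀ {Z : FinGSet G} (r : B →[G] Z),
        tr h ≫ rs p ≫ nm q ≫ tr r = rs p' ≫ nm q' ≫ tr (r.comp k)) ∧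
      (∀ (S : TambaraFunctor.{w} G) (x : S.obj.obj (.of X)),
        S.obj.map (nm q) (S.obj.map (rs p) (S.obj.map (tr h) x)) =
          S.obj.map (tr k) (S.obj.map (nm q') (S.obj.map (rs p') x))) ∧
      (∀ (S : TambaraFunctor.{w} G) (y : S.obj.obj (.of Y)),
        S.obj.map (nm q') (S.obj.map (rs p') (S.obj.map (rs h) y)) =
          S.obj.map (rs k) (S.obj.map (nm q) (S.obj.map (rs p) y))) := by
  obtain ⟨A', B', p', q', k, a, e, hpb, ha⟩ := exists_tr_comp h p q
  refine ⟨A', B', p', q', k, fun r => ?_, fun S x => ?_, fun S y => ?_⟩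
  · rw [← tr_comp, ← Category.assoc (rs p), ← Category.assoc (tr h), e]
    simp only [Category.assoc]
  · simp only [← Functor.map_comp_apply, Category.assoc]
    rw [e]
  · simp only [← Functor.map_comp_apply]
    rw [rs_comp, ha, Category.assoc (rs p), nm_rs hpb, ← rs_comp, Category.assoc]

section Hom

variable {S' : TambaraFunctor.{w} G} (φ : S ⟶ S')

theorem map_pair (x : S.obj.obj (.of X)) (y : S.obj.obj (.of Y)) :
    φ.hom.app _ (pair x y) = pair (φ.hom.app _ x) (φ.hom.app _ y) :=
  sum_ext (by rw [← NatTrans.naturality_apply]; simp) (by rw [← NatTrans.naturality_apply]; simp)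

theorem map_mul (x y : S.obj.obj (.of X)) :
    φ.hom.app _ (mul x y) = mul (φ.hom.app _ x) (φ.hom.app _ y) := by
  rw [mul, NatTrans.naturality_apply, map_pair, mul]

theorem map_one (X : FinGSet G) : φ.hom.app _ (S.one X) = S'.one X := by
  rw [one_def, NatTrans.naturality_apply, one_def]
  exact congrArg _ (Subsingleton.elim _ _)

end Hom

end TambaraFunctor

/-! ### The Tambara structure on the box product -/

namespace TambaraFunctor

open FinGSet BispanCat

variable {G : Type u} [Group G] [Finite G] {M N : TambaraFunctor.{w} G} {X Y Z W : FinGSet G}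

/-- The box product of the underlying Mackey functors of `M` and `N`. -/
noncomputable abbrev box (M N : TambaraFunctor.{w} G) : SpanCat G ⥤ Type w :=
  boxProd M.toMackey N.toMackey

/-- The element `m ⊗ n` of the box product of two Tambara functors. -/
noncomputable abbrev tens (m : M.obj.obj (.of X)) (n : N.obj.obj (.of X)) :
    (box M N).obj (.of X) :=
  tensorElt (M := M.toMackey) (N := N.toMackey) m n

theorem map_rs_tens (f : X →[G] Y) (m : M.obj.obj (.of Y)) (n : N.obj.obj (.of Y)) :
    (box M N).map (SpanCat.rs f) (tens m n) =
      tens (M.obj.map (rs f) m) (N.obj.map (rs f) n) :=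
  SpanCat.map_rs_tensorElt (M := M.toMackey) (N := N.toMackey) f m n

theorem map_tr_tens_left (h : X →[G] Y) (m : M.obj.obj (.of X)) (n : N.obj.obj (.of Y)) :
    (box M N).map (SpanCat.tr h) (tens m (N.obj.map (rs h) n)) =
      tens (M.obj.map (tr h) m) n :=
  SpanCat.map_tr_tensorElt_left (M := M.toMackey) (N := N.toMackey) h m n

theorem map_tr_tens_right (h : X →[G] Y) (m : M.obj.obj (.of Y)) (n : N.obj.obj (.of X)) :
    (box M N).map (SpanCat.tr h) (tens (M.obj.map (rs h) m) n) =
      tens m (N.obj.map (tr h) n) :=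
  SpanCat.map_tr_tensorElt_right (M := M.toMackey) (N := N.toMackey) h m n

theorem exists_eq_map_tr_tens (x : (box M N).obj (.of X)) :
    ∃ (E : FinGSet G) (f : E →[G] X) (m : M.obj.obj (.of E)) (n : N.obj.obj (.of E)),
      x = (box M N).map (SpanCat.tr f) (tens m n) :=
  SpanCat.exists_eq_map_tr_tensorElt (M := M.toMackey) (N := N.toMackey) x

/-- `SpanCat.exists_lift` for the box product of Tambara functors. -/
theorem exists_box_lift {S : Type w}
    (φ : ∀ {E : FinGSet G}, (E →[G] X) → M.obj.obj (.of E) → N.obj.obj (.of E) → S)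
    (hl : ∀ {E E' : FinGSet G} (h : E' →[G] E) (f : E →[G] X) (m : M.obj.obj (.of E'))
      (n : N.obj.obj (.of E)), φ (f.comp h) m (N.obj.map (rs h) n) = φ f (M.obj.map (tr h) m) n)
    (hr : ∀ {E E' : FinGSet G} (h : E' →[G] E) (f : E →[G] X) (m : M.obj.obj (.of E))
      (n : N.obj.obj (.of E')), φ (f.comp h) (M.obj.map (rs h) m) n = φ f m (N.obj.map (tr h) n)) :
    ∃ Φ : (box M N).obj (.of X) → S,
      ∀ {E : FinGSet G} (f : E →[G] X) (m : M.obj.obj (.of E)) (n : N.obj.obj (.of E)),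
        Φ ((box M N).map (SpanCat.tr f) (tens m n)) = φ f m n :=
  SpanCat.exists_lift (M := M.toMackey) (N := N.toMackey) φ hl hr

/-- The element `T_r(N_q R_p(m) ⊗ N_q R_p(n))` attached to a bispan `X ← A → B → Y` with maps `p`,
`q`, `r`. This is the value which a multiplicative Tambara structure must give to the image of
`m ⊗ n` under the bispan. -/
noncomputable def bispanTens (ω : BispanCat.of X ⟶ .of Y) (m : M.obj.obj (.of X))
    (n : N.obj.obj (.of X)) : (box M N).obj (.of Y) :=
  Quotient.lift (fun s : Bispan X Y => (box M N).map (SpanCat.tr s.r)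
    (tens (M.obj.map (rs s.p ≫ nm s.q) m) (N.obj.map (rs s.p ≫ nm s.q) n))) (by
    rintro s t ⟨α, β, hα, hβ, hp, hq, hr⟩
    let a : s.A →[G] t.A := ⟨α, hα⟩
    let b : s.B →[G] t.B := ⟨β, hβ⟩
    have h1 : s.r = t.r.comp b := MulActionHom.ext fun a => (hr a).symm
    have h2 : s.p = t.p.comp a := MulActionHom.ext fun a => (hp a).symm
    have h3 : IsPb a s.q t.q b := ⟨hq, fun x y h => ⟨α.symm x, α.apply_symm_apply x,
      β.injective (by rw [← hq, Equiv.apply_symm_apply]; exact h)⟩,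
      fun _ _ h _ => α.injective h⟩
    have h4 : rs s.p ≫ nm s.q = (rs t.p ≫ nm t.q) ≫ rs b := by
      rw [h2, ← rs_comp, Category.assoc, ← nm_rs h3, Category.assoc]
    simp only [h1, h4]
    rw [← SpanCat.tr_comp, M.obj.map_comp_apply, N.obj.map_comp_apply, ← map_rs_tens,
      ← Functor.map_comp_apply, ← Category.assoc, SpanCat.rs_tr_of_bijective b β.bijective,
      Category.id_comp]) ω

theorem bispanTens_mk {A B : FinGSet G} (p : A →[G] X) (q : A →[G] B) (r : B →[G] Y)
    (m : M.obj.obj (.of X)) (n : N.obj.obj (.of X)) :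
    bispanTens (rs p ≫ nm q ≫ tr r) m n = (box M N).map (SpanCat.tr r)
      (tens (M.obj.map (nm q) (M.obj.map (rs p) m)) (N.obj.map (nm q) (N.obj.map (rs p) n))) := by
  rw [← homMk_eq ⟨A, B, p, q, r⟩, ← Functor.map_comp_apply, ← Functor.map_comp_apply]
  rfl

/-- The elements `bispanTens ω m n` satisfy Frobenius reciprocity in the first variable. -/
theorem bispanTens_tr_left (h : X →[G] Y) (ω : BispanCat.of Y ⟶ .of Z) (m : M.obj.obj (.of X))
    (n : N.obj.obj (.of Y)) :
    bispanTens (tr h ≫ ω) m (N.obj.map (rs h) n) = bispanTens ω (M.obj.map (tr h) m) n := by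
  induction ω using hom_ind with | _ A B p q r
  obtain ⟨A', B', p', q', k, e, e₁, e₂⟩ := exists_nm_tr h p q
  rw [e, bispanTens_mk, bispanTens_mk, e₁, e₂, ← SpanCat.tr_comp, Functor.map_comp_apply,
    map_tr_tens_left]

/-- The elements `bispanTens ω m n` satisfy Frobenius reciprocity in the second variable. -/
theorem bispanTens_tr_right (h : X →[G] Y) (ω : BispanCat.of Y ⟶ .of Z) (m : M.obj.obj (.of Y))
    (n : N.obj.obj (.of X)) :
    bispanTens (tr h ≫ ω) (M.obj.map (rs h) m) n = bispanTens ω m (N.obj.map (tr h) n) := by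
  induction ω using hom_ind with | _ A B p q r
  obtain ⟨A', B', p', q', k, e, e₁, e₂⟩ := exists_nm_tr h p q
  rw [e, bispanTens_mk, bispanTens_mk, e₁, e₂, ← SpanCat.tr_comp, Functor.map_comp_apply,
    map_tr_tens_right]

/-- Restrictions and norms can be moved from the bispan to the tensor factors. -/
theorem bispanTens_rs_nm {B : FinGSet G} (p : Z →[G] X) (q : Z →[G] B)
    (v : BispanCat.of B ⟶ .of Y) (m : M.obj.obj (.of X)) (n : N.obj.obj (.of X)) :
    bispanTens v (M.obj.map (nm q) (M.obj.map (rs p) m)) (N.obj.map (nm q) (N.obj.map (rs p) n)) =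
      bispanTens (rs p ≫ nm q ≫ v) m n := by
  induction v using hom_ind with | _ C D p' q' r
  have h := isPb_pb q p'
  have e : rs p ≫ nm q ≫ rs p' ≫ nm q' =
      rs (p.comp (pbFst q p')) ≫ nm (q'.comp (pbSnd q p')) := by
    rw [← Category.assoc (nm q), nm_rs h, ← rs_comp, ← nm_comp]
    simp only [Category.assoc]
  have e' : rs p ≫ nm q ≫ rs p' ≫ nm q' ≫ tr r =
      rs (p.comp (pbFst q p')) ≫ nm (q'.comp (pbSnd q p')) ≫ tr r := by
    rw [← Category.assoc (rs (p.comp _)), ← e]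
    simp only [Category.assoc]
  rw [e', bispanTens_mk, bispanTens_mk]
  simp only [← Functor.map_comp_apply, Category.assoc, e]

/-- The formula for the action of a bispan respects Frobenius reciprocity. -/
theorem exists_boxMap (ω : BispanCat.of X ⟶ .of Y) :
    ∃ Φ : (box M N).obj (.of X) → (box M N).obj (.of Y),
      ∀ {E : FinGSet G} (f : E →[G] X) (m : M.obj.obj (.of E)) (n : N.obj.obj (.of E)),
        Φ ((box M N).map (SpanCat.tr f) (tens m n)) = bispanTens (tr f ≫ ω) m n :=
  exists_box_lift (fun f m n => bispanTens (tr f ≫ ω) m n)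
    (fun h f m n => by rw [← tr_comp, Category.assoc, bispanTens_tr_left])
    (fun h f m n => by rw [← tr_comp, Category.assoc, bispanTens_tr_right])

/-- The action of a bispan on the box product. -/
noncomputable def boxMap (ω : BispanCat.of X ⟶ .of Y) :
    (box M N).obj (.of X) → (box M N).obj (.of Y) :=
  (exists_boxMap ω).choose

theorem boxMap_map_tr_tens (ω : BispanCat.of X ⟶ .of Y) {E : FinGSet G} (f : E →[G] X)
    (m : M.obj.obj (.of E)) (n : N.obj.obj (.of E)) :
    boxMap ω ((box M N).map (SpanCat.tr f) (tens m n)) = bispanTens (tr f ≫ ω) m n :=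
  (exists_boxMap ω).choose_spec f m n

theorem boxMap_tens (ω : BispanCat.of X ⟶ .of Y) (m : M.obj.obj (.of X)) (n : N.obj.obj (.of X)) :
    boxMap ω (tens m n) = bispanTens ω m n := by
  have h := boxMap_map_tr_tens ω (MulActionHom.id G) m n
  rwa [SpanCat.tr_id, Functor.map_id_apply, tr_id, Category.id_comp] at h

/-- On spans the prescribed action is the one given by the Mackey functor `M ⊠ N`. -/
theorem bispanTens_span (f : SpanCat.of X ⟶ .of Y) (m : M.obj.obj (.of X))
    (n : N.obj.obj (.of X)) :
    bispanTens ((spanToBispan G).map f) m n = (box M N).map f (tens m n) := by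
  obtain ⟨s, rfl⟩ : ∃ s, f = SpanCat.homMk s := ⟨_, (Quotient.exists_rep f).choose_spec.symm⟩
  have e : (spanToBispan G).map (SpanCat.homMk s) =
      rs s.p ≫ nm (MulActionHom.id G) ≫ tr s.q := homMk_eq s.toBispan
  rw [e, bispanTens_mk, nm_id, Functor.map_id_apply, Functor.map_id_apply, SpanCat.homMk_eq,
    Functor.map_comp_apply, map_rs_tens]

/-- The action of bispans on the box product of two Tambara functors. -/
noncomputable def boxAction (M N : TambaraFunctor.{w} G) : BispanAction (box M N) where
  map := boxMap
  map_id x := by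
    obtain ⟨E, f, m, n, rfl⟩ := exists_eq_map_tr_tens x
    rw [boxMap_map_tr_tens, Category.comp_id]
    exact bispanTens_span (SpanCat.tr f) m n
  map_comp ω ω' x := by
    obtain ⟨E, f, m, n, rfl⟩ := exists_eq_map_tr_tens x
    rw [boxMap_map_tr_tens, boxMap_map_tr_tens, ← Category.assoc]
    generalize tr f ≫ ω = v
    induction v using hom_ind with | _ A B p q r
    rw [bispanTens_mk, boxMap_map_tr_tens, bispanTens_rs_nm]
    simp only [Category.assoc]
  map_span f x := by
    obtain ⟨E, g, m, n, rfl⟩ := exists_eq_map_tr_tens x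
    refine (boxMap_map_tr_tens ((spanToBispan G).map f) g m n).trans ?_
    rw [← Functor.map_comp_apply, ← bispanTens_span, Functor.map_comp]
    rfl

/-! ### The box product preserves products -/

/-- Every element of `(M ⊠ N)(X ⊔ Y)` is assembled from an element over `X` and one over `Y`. -/
theorem exists_eq_map_sumMap (z : (box M N).obj (.of (X.sum Y))) :
    ∃ (E₁ E₂ : FinGSet G) (f₁ : E₁ →[G] X) (f₂ : E₂ →[G] Y) (m₁ : M.obj.obj (.of E₁))
      (m₂ : M.obj.obj (.of E₂)) (n₁ : N.obj.obj (.of E₁)) (n₂ : N.obj.obj (.of E₂)),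
      z = (box M N).map (SpanCat.tr (sumMap f₁ f₂)) (tens (pair m₁ m₂) (pair n₁ n₂)) := by
  obtain ⟨E, f, m, n, rfl⟩ := exists_eq_map_tr_tens z
  have h₁ := isPb_pb f (inl X Y)
  have h₂ := isPb_pb f (inr X Y)
  let e := sumElim (pbFst f (inl X Y)) (pbFst f (inr X Y))
  have he : f.comp e = sumMap (pbSnd f (inl X Y)) (pbSnd f (inr X Y)) :=
    MulActionHom.ext fun x => by
      rcases x with x | x
      · exact h₁.comm x
      · exact h₂.comm x
  refine ⟨_, _, pbSnd f (inl X Y), pbSnd f (inr X Y),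
    M.obj.map (rs (inl _ _)) (M.obj.map (rs e) m), M.obj.map (rs (inr _ _)) (M.obj.map (rs e) m),
    N.obj.map (rs (inl _ _)) (N.obj.map (rs e) n), N.obj.map (rs (inr _ _)) (N.obj.map (rs e) n),
    ?_⟩
  rw [pair_eta, pair_eta, ← map_rs_tens, ← he, ← SpanCat.tr_comp, ← Functor.map_comp_apply,
    ← Category.assoc, SpanCat.rs_tr_of_bijective e (bijective_sumElim h₁ h₂), Category.id_comp]

section Sum

variable {E₁ E₂ : FinGSet G} (f₁ : E₁ →[G] X) (f₂ : E₂ →[G] Y) (m₁ : M.obj.obj (.of E₁))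
  (m₂ : M.obj.obj (.of E₂)) (n₁ : N.obj.obj (.of E₁)) (n₂ : N.obj.obj (.of E₂))

theorem map_rs_inl_sumMap :
    (box M N).map (SpanCat.rs (inl X Y))
      ((box M N).map (SpanCat.tr (sumMap f₁ f₂)) (tens (pair m₁ m₂) (pair n₁ n₂))) =
      (box M N).map (SpanCat.tr f₁) (tens m₁ n₁) := by
  rw [← Functor.map_comp_apply, SpanCat.tr_rs (isPb_inl f₁ f₂), Functor.map_comp_apply,
    map_rs_tens, rs_inl_pair, rs_inl_pair]

theorem map_rs_inr_sumMap :
    (box M N).map (SpanCat.rs (inr X Y))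
      ((box M N).map (SpanCat.tr (sumMap f₁ f₂)) (tens (pair m₁ m₂) (pair n₁ n₂))) =
      (box M N).map (SpanCat.tr f₂) (tens m₂ n₂) := by
  rw [← Functor.map_comp_apply, SpanCat.tr_rs (isPb_inr f₁ f₂), Functor.map_comp_apply,
    map_rs_tens, rs_inr_pair, rs_inr_pair]

/-- Juxtaposition with a fixed element over `Y` is well defined on `(M ⊠ N)(X)`. -/
theorem exists_sum_right : ∃ Φ : (box M N).obj (.of X) → (box M N).obj (.of (X.sum Y)),
    ∀ {E : FinGSet G} (f : E →[G] X) (m : M.obj.obj (.of E)) (n : N.obj.obj (.of E)),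
      Φ ((box M N).map (SpanCat.tr f) (tens m n)) =
        (box M N).map (SpanCat.tr (sumMap f f₂)) (tens (pair m m₂) (pair n n₂)) := by
  have e : ∀ {E E' : FinGSet G} (h : E' →[G] E) (f : E →[G] X), sumMap (f.comp h) f₂ =
      (sumMap f f₂).comp (sumMap h (MulActionHom.id G)) := fun h f =>
    MulActionHom.ext fun x => by cases x <;> rfl
  refine exists_box_lift _ (fun h f m n => ?_) (fun h f m n => ?_)
  · have e' := rs_pair h (MulActionHom.id G) n n₂
    have e'' := tr_pair h (MulActionHom.id G) m m₂
    rw [rs_id, Functor.map_id_apply] at e'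
    rw [tr_id, Functor.map_id_apply] at e''
    rw [e, ← SpanCat.tr_comp, Functor.map_comp_apply, ← e', ← e'', map_tr_tens_left]
  · have e' := rs_pair h (MulActionHom.id G) m m₂
    have e'' := tr_pair h (MulActionHom.id G) n n₂
    rw [rs_id, Functor.map_id_apply] at e'
    rw [tr_id, Functor.map_id_apply] at e''
    rw [e, ← SpanCat.tr_comp, Functor.map_comp_apply, ← e', ← e'', map_tr_tens_right]

/-- Juxtaposition with a fixed element over `X` is well defined on `(M ⊠ N)(Y)`. -/
theorem exists_sum_left : ∃ Φ : (box M N).obj (.of Y) → (box M N).obj (.of (X.sum Y)),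
    ∀ {E : FinGSet G} (f : E →[G] Y) (m : M.obj.obj (.of E)) (n : N.obj.obj (.of E)),
      Φ ((box M N).map (SpanCat.tr f) (tens m n)) =
        (box M N).map (SpanCat.tr (sumMap f₁ f)) (tens (pair m₁ m) (pair n₁ n)) := by
  have e : ∀ {E E' : FinGSet G} (h : E' →[G] E) (f : E →[G] Y), sumMap f₁ (f.comp h) =
      (sumMap f₁ f).comp (sumMap (MulActionHom.id G) h) := fun h f =>
    MulActionHom.ext fun x => by cases x <;> rfl
  refine exists_box_lift _ (fun h f m n => ?_) (fun h f m n => ?_)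
  · have e' := rs_pair (MulActionHom.id G) h n₁ n
    have e'' := tr_pair (MulActionHom.id G) h m₁ m
    rw [rs_id, Functor.map_id_apply] at e'
    rw [tr_id, Functor.map_id_apply] at e''
    rw [e, ← SpanCat.tr_comp, Functor.map_comp_apply, ← e', ← e'', map_tr_tens_left]
  · have e' := rs_pair (MulActionHom.id G) h m₁ m
    have e'' := tr_pair (MulActionHom.id G) h n₁ n
    rw [rs_id, Functor.map_id_apply] at e'
    rw [tr_id, Functor.map_id_apply] at e''
    rw [e, ← SpanCat.tr_comp, Functor.map_comp_apply, ← e', ← e'', map_tr_tens_right]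

end Sum

/-- An element of `(M ⊠ N)(X ⊔ Y)` is determined by its restrictions to `X` and `Y`. -/
theorem box_sum_ext (z z' : (box M N).obj (.of (X.sum Y)))
    (h₁ : (box M N).map (SpanCat.rs (inl X Y)) z = (box M N).map (SpanCat.rs (inl X Y)) z')
    (h₂ : (box M N).map (SpanCat.rs (inr X Y)) z = (box M N).map (SpanCat.rs (inr X Y)) z') :
    z = z' := by
  obtain ⟨E₁, E₂, f₁, f₂, m₁, m₂, n₁, n₂, rfl⟩ := exists_eq_map_sumMap z
  obtain ⟨E₁', E₂', f₁', f₂', m₁', m₂', n₁', n₂', rfl⟩ := exists_eq_map_sumMap z'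
  rw [map_rs_inl_sumMap, map_rs_inl_sumMap] at h₁
  rw [map_rs_inr_sumMap, map_rs_inr_sumMap] at h₂
  -- The first component is replaced first, and then the second.
  obtain ⟨Φ, hΦ⟩ := exists_sum_right (X := X) f₂ m₂ n₂
  obtain ⟨Ψ, hΨ⟩ := exists_sum_left (Y := Y) f₁' m₁' n₁'
  rw [← hΦ, h₁, hΦ, ← hΨ, h₂, hΨ]

/-- The set `(M ⊠ N)(∅)` has exactly one element. -/
theorem nonempty_unique_box_empty : Nonempty (Unique ((box M N).obj (.of (empty G)))) := by
  refine ⟨⟨⟨tens default default⟩, fun x => ?_⟩⟩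
  obtain ⟨E, f, m, n, rfl⟩ := exists_eq_map_tr_tens x
  have hf : Function.Bijective f := ⟨fun x => PEmpty.elim (f x), fun x => PEmpty.elim x⟩
  -- The set `E` is empty as well, so `S(E)` has just one element.
  have key : ∀ (S : TambaraFunctor.{w} G) (s : S.obj.obj (.of E)),
      s = S.obj.map (rs f) default := fun S s => by
    have h : tr f ≫ rs f = 𝟙 _ := by
      rw [tr_rs (isPb_id_of_injective f hf.1), rs_id, tr_id, Category.comp_id]
    rw [← Functor.map_id_apply S.obj _ s, ← h, Functor.map_comp_apply]
    exact congrArg _ (Subsingleton.elim _ _)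
  rw [key M m, key N n, ← map_rs_tens, ← Functor.map_comp_apply,
    SpanCat.rs_tr_of_bijective f hf, Functor.map_id_apply]
  rfl

/-- The Tambara structure on the box product of two Tambara functors. -/
noncomputable def boxStructure (M N : TambaraFunctor.{w} G) : TambaraStructure (box M N) where
  toBispanAction := boxAction M N
  preserves := by
    have e : ∀ {X Y : FinGSet G} (f : X →[G] Y) (x : (box M N).obj (.of Y)),
        (boxAction M N).functor.map (rs f) x = (box M N).map (SpanCat.rs f) x := fun f x =>
      (boxAction M N).map_span (SpanCat.rs f) x
    refine preservesFiniteProducts_of_bijective _ nonempty_unique_box_empty (fun {X Y} x y => ?_)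
      (fun {X Y} z z' h h' => ?_)
    · obtain ⟨E₁, f₁, m₁, n₁, rfl⟩ := exists_eq_map_tr_tens (M := M) (N := N) (X := X) x
      obtain ⟨E₂, f₂, m₂, n₂, rfl⟩ := exists_eq_map_tr_tens (M := M) (N := N) (X := Y) y
      exact ⟨(box M N).map (SpanCat.tr (sumMap f₁ f₂)) (tens (pair m₁ m₂) (pair n₁ n₂)),
        (e _ _).trans (map_rs_inl_sumMap _ _ _ _ _ _),
        (e _ _).trans (map_rs_inr_sumMap _ _ _ _ _ _)⟩
    · exact box_sum_ext z z' ((e _ z).symm.trans (h.trans (e _ z')))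
        ((e _ z).symm.trans (h'.trans (e _ z')))

end TambaraFunctor

/-! ### Uniqueness, and the universal property -/

namespace TambaraStructure

open BispanCat

variable {G : Type u} [Group G] {P : SpanCat G ⥤ Type w} (T : TambaraStructure P) {X Y : FinGSet G}

theorem map_tr (f : X →[G] Y) (x : P.obj (.of X)) : T.map (tr f) x = P.map (SpanCat.tr f) x :=
  T.map_span (SpanCat.tr f) x

theorem map_rs (f : X →[G] Y) (x : P.obj (.of Y)) : T.map (rs f) x = P.map (SpanCat.rs f) x :=
  T.map_span (SpanCat.rs f) x

end TambaraStructure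

namespace TambaraFunctor

open FinGSet BispanCat

variable {G : Type u} [Group G] [Finite G] {M N : TambaraFunctor.{w} G} {X Y Z W : FinGSet G}

theorem isMultiplicativeNorm_boxStructure (M N : TambaraFunctor.{w} G) :
    IsMultiplicativeNorm (boxStructure M N) := fun X Y f m n => by
  refine (boxMap_tens (nm f) m n).trans ?_
  have e : nm f = rs (MulActionHom.id G) ≫ nm f ≫ tr (MulActionHom.id G) := by
    rw [rs_id, tr_id, Category.id_comp, Category.comp_id]
  rw [e, bispanTens_mk, SpanCat.tr_id, rs_id, Functor.map_id_apply, Functor.map_id_apply,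
    Functor.map_id_apply]
  rfl

section Structure

variable {T : TambaraStructure (box M N)}

variable (hT : IsMultiplicativeNorm T)
include hT

theorem map_nm_tens (f : X →[G] Y) (m : M.obj.obj (.of X)) (n : N.obj.obj (.of X)) :
    T.map (nm f) (tens m n) = tens (M.obj.map (nm f) m) (N.obj.map (nm f) n) := hT f m n

/-- A multiplicative Tambara structure is determined on the elements `m ⊗ n`. -/
theorem map_tens (ω : BispanCat.of X ⟶ .of Y) (m : M.obj.obj (.of X)) (n : N.obj.obj (.of X)) :
    T.map ω (tens m n) = bispanTens ω m n := by
  induction ω using hom_ind with | _ A B p q r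
  rw [T.map_comp, T.map_comp, T.map_rs, map_rs_tens, map_nm_tens hT,
    T.map_tr, bispanTens_mk]

theorem map_map_tr_tens {E : FinGSet G} (ω : BispanCat.of X ⟶ .of Y) (f : E →[G] X)
    (m : M.obj.obj (.of E)) (n : N.obj.obj (.of E)) :
    T.map ω ((box M N).map (SpanCat.tr f) (tens m n)) = bispanTens (tr f ≫ ω) m n := by
  rw [← T.map_tr, ← T.map_comp, map_tens hT]

theorem eq_boxStructure : T = boxStructure M N := by
  have e : T.toBispanAction = boxAction M N := by
    refine BispanAction.ext ?_
    funext X Y ω x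
    obtain ⟨E, f, m, n, rfl⟩ := exists_eq_map_tr_tens x
    exact (map_map_tr_tens hT ω f m n).trans (boxMap_map_tr_tens ω f m n).symm
  obtain ⟨T, _⟩ := T
  subst e
  rfl

end Structure

/-- The element `m ⊗ 1` is natural in `m`. -/
theorem bispanTens_one_right (ω : BispanCat.of X ⟶ .of Y) (m : M.obj.obj (.of X)) :
    bispanTens ω m (N.one X) = tens (M.obj.map ω m) (N.one Y) := by
  induction ω using hom_ind with | _ A B p q r
  rw [bispanTens_mk, rs_one, nm_one, ← rs_one r, map_tr_tens_left, Functor.map_comp_apply,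
    Functor.map_comp_apply]

/-- The element `1 ⊗ n` is natural in `n`. -/
theorem bispanTens_one_left (ω : BispanCat.of X ⟶ .of Y) (n : N.obj.obj (.of X)) :
    bispanTens ω (M.one X) n = tens (M.one Y) (N.obj.map ω n) := by
  induction ω using hom_ind with | _ A B p q r
  rw [bispanTens_mk, rs_one, nm_one, ← rs_one r, map_tr_tens_right, Functor.map_comp_apply,
    Functor.map_comp_apply]

section Coproduct

variable {T : TambaraStructure (box M N)} (hT : IsMultiplicativeNorm T)

/-- The coproduct inclusion `m ↦ m ⊗ 1`. -/
noncomputable def tensOne : M ⟶ T.toTambaraFunctor :=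
  ObjectProperty.homMk
    { app := fun X => TypeCat.ofHom fun m => tens (X := X.set) m (N.one X.set)
      naturality := fun X Y ω => by
        ext m
        exact (bispanTens_one_right (X := X.set) (Y := Y.set) ω m).symm.trans
          (map_tens hT (X := X.set) (Y := Y.set) ω m (N.one X.set)).symm }

/-- The coproduct inclusion `n ↦ 1 ⊗ n`. -/
noncomputable def oneTens : N ⟶ T.toTambaraFunctor :=
  ObjectProperty.homMk
    { app := fun X => TypeCat.ofHom fun n => tens (X := X.set) (M.one X.set) n
      naturality := fun X Y ω => by
        ext n
        exact (bispanTens_one_left (X := X.set) (Y := Y.set) ω n).symm.trans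
          (map_tens hT (X := X.set) (Y := Y.set) ω (M.one X.set) n).symm }

include hT in
theorem mul_tens (m m' : M.obj.obj (.of X)) (n n' : N.obj.obj (.of X)) :
    mul (S := T.toTambaraFunctor) (X := X) (tens m n) (tens m' n') =
      tens (mul m m') (mul n n') := by
  have e : pair (S := T.toTambaraFunctor) (X := X) (Y := X) (tens m n) (tens m' n') =
      tens (pair m m') (pair n n') := by
    refine sum_ext (S := T.toTambaraFunctor) ((rs_inl_pair (S := T.toTambaraFunctor) _ _).trans ?_)
      ((rs_inr_pair (S := T.toTambaraFunctor) _ _).trans ?_)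
    · refine Eq.trans ?_ (T.map_rs (inl X X) _).symm
      rw [map_rs_tens, rs_inl_pair, rs_inl_pair]
    · refine Eq.trans ?_ (T.map_rs (inr X X) _).symm
      rw [map_rs_tens, rs_inr_pair, rs_inr_pair]
  refine (congrArg (T.map (nm (fold X))) e).trans ?_
  exact map_nm_tens hT (fold X) _ _

include hT in
theorem mul_tens_one (m : M.obj.obj (.of X)) (n : N.obj.obj (.of X)) :
    mul (S := T.toTambaraFunctor) (X := X) (tens m (N.one X)) (tens (M.one X) n) = tens m n := by
  rw [mul_tens hT, mul_one, one_mul]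

variable {S : TambaraFunctor.{w} G} (φ : M ⟶ S) (ψ : N ⟶ S)

/-- The function `T_f(m ⊗ n) ↦ T_f(φ(m) ψ(n))` is well defined, by Frobenius reciprocity in `S`. -/
theorem exists_descFun (X : FinGSet G) : ∃ Φ : (box M N).obj (.of X) → S.obj.obj (.of X),
    ∀ {E : FinGSet G} (f : E →[G] X) (m : M.obj.obj (.of E)) (n : N.obj.obj (.of E)),
      Φ ((box M N).map (SpanCat.tr f) (tens m n)) =
        S.obj.map (tr f) (mul (φ.hom.app _ m) (ψ.hom.app _ n)) :=
  exists_box_lift _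
    (fun h f m n => by
      rw [NatTrans.naturality_apply, NatTrans.naturality_apply, tr_mul, ← tr_comp,
        Functor.map_comp_apply])
    (fun h f m n => by
      rw [NatTrans.naturality_apply, NatTrans.naturality_apply, mul_tr, ← tr_comp,
        Functor.map_comp_apply])

/-- The function `T_f(m ⊗ n) ↦ T_f(φ(m) ψ(n))`, which underlies `desc`. -/
noncomputable def descFun (X : FinGSet G) : (box M N).obj (.of X) → S.obj.obj (.of X) :=
  (exists_descFun φ ψ X).choose

theorem descFun_map_tr_tens {E : FinGSet G} (f : E →[G] X) (m : M.obj.obj (.of E))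
    (n : N.obj.obj (.of E)) : descFun φ ψ X ((box M N).map (SpanCat.tr f) (tens m n)) =
      S.obj.map (tr f) (mul (φ.hom.app _ m) (ψ.hom.app _ n)) :=
  (exists_descFun φ ψ X).choose_spec f m n

theorem descFun_tens (m : M.obj.obj (.of X)) (n : N.obj.obj (.of X)) :
    descFun φ ψ X (tens m n) = mul (φ.hom.app _ m) (ψ.hom.app _ n) := by
  have h := descFun_map_tr_tens φ ψ (MulActionHom.id G) m n
  rwa [SpanCat.tr_id, Functor.map_id_apply, tr_id, Functor.map_id_apply] at h

theorem descFun_bispanTens (ω : BispanCat.of X ⟶ .of Y) (m : M.obj.obj (.of X))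
    (n : N.obj.obj (.of X)) : descFun φ ψ Y (bispanTens ω m n) =
      S.obj.map ω (mul (φ.hom.app _ m) (ψ.hom.app _ n)) := by
  induction ω using hom_ind with | _ A B p q r
  rw [bispanTens_mk, descFun_map_tr_tens, Functor.map_comp_apply, Functor.map_comp_apply, rs_mul,
    nm_mul]
  simp only [NatTrans.naturality_apply]

/-- The morphism out of the box product induced by morphisms out of its factors. -/
noncomputable def desc : T.toTambaraFunctor ⟶ S :=
  ObjectProperty.homMk
    { app := fun X => TypeCat.ofHom (descFun φ ψ X.set)
      naturality := fun X Y ω => by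
        ext x
        obtain ⟨E, f, m, n, rfl⟩ := exists_eq_map_tr_tens (M := M) (N := N) (X := X.set) x
        change descFun φ ψ Y.set (T.map (X := X.set) (Y := Y.set) ω _) =
          S.obj.map ω (descFun φ ψ X.set _)
        rw [map_map_tr_tens hT, descFun_bispanTens, descFun_map_tr_tens]
        exact Functor.map_comp_apply _ _ _ _ }

/-- The box product is the coproduct of Tambara functors. -/
noncomputable def isColimitBox : IsColimit (BinaryCofan.mk (tensOne hT) (oneTens hT)) :=
  BinaryCofan.IsColimit.mk _ (fun {S} φ ψ => desc hT φ ψ)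
    (fun {S} φ ψ => by
      ext X m
      refine (descFun_tens φ ψ (X := X.set) m (N.one X.set)).trans ?_
      rw [map_one]
      exact mul_one _)
    (fun {S} φ ψ => by
      ext X n
      refine (descFun_tens φ ψ (X := X.set) (M.one X.set) n).trans ?_
      rw [map_one]
      exact one_mul _)
    (fun {S} φ ψ θ h₁ h₂ => by
      subst h₁ h₂
      ext X x
      obtain ⟨E, f, m, n, rfl⟩ := exists_eq_map_tr_tens (M := M) (N := N) (X := X.set) x
      refine Eq.trans ?_ (descFun_map_tr_tens _ _ f m n).symm
      have h : θ.hom.app (.of E) (tens m n) = mul (θ.hom.app (.of E) (tens m (N.one E)))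
          (θ.hom.app (.of E) (tens (M.one E) n)) := by
        rw [← mul_tens_one hT m n]
        exact map_mul θ _ _
      rw [← T.map_tr]
      refine (NatTrans.naturality_apply θ.hom (tr f) (tens m n)).trans ?_
      rw [h]
      rfl)

end Coproduct

end TambaraFunctor

theorem mainTheorem4 {G : Type u} [Group G] [Finite G] (M N : TambaraFunctor.{w} G) :
    (∃! T : TambaraStructure (boxProd M.toMackey N.toMackey), IsMultiplicativeNorm T) ∧
    ∀ T : TambaraStructure (boxProd M.toMackey N.toMackey), IsMultiplicativeNorm T →
      ∃ (i : M ⟶ T.toTambaraFunctor) (j : N ⟶ T.toTambaraFunctor),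
        (∀ (X : FinGSet G) (m : M.obj.obj (.of X)),
          i.hom.app (.of X) m =
            tensorElt (M := M.toMackey) (N := N.toMackey) m (N.one X)) ∧
        (∀ (X : FinGSet G) (n : N.obj.obj (.of X)),
          j.hom.app (.of X) n =
            tensorElt (M := M.toMackey) (N := N.toMackey) (M.one X) n) ∧
        Nonempty (IsColimit (BinaryCofan.mk i j)) :=
  ⟨⟨TambaraFunctor.boxStructure M N, TambaraFunctor.isMultiplicativeNorm_boxStructure M N,
    fun _ hT => TambaraFunctor.eq_boxStructure hT⟩,
    fun _ hT => ⟨TambaraFunctor.tensOne hT, TambaraFunctor.oneTens hT, fun _ _ => rfl,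
      fun _ _ => rfl, ⟨TambaraFunctor.isColimitBox hT⟩⟩⟩
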